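/- Let $m=(m_0,m_1,\dots)$ be a bounded sequence of integers $m_k\ge 2$, let $G_m=\prod_{k\ge 0}\mathbb Z/m_k\mathbb Z$ be the corresponding bounded Vilenkin group, with $\mu$ the product of the uniform probability measures on the factors. Put $M_0=1$, $M_{k+1}=m_kM_k$, write $n=\sum_k n_kM_k$ with $0\le n_k<m_k$, and let $\psi_n(x)=\prod_{k}\exp(2\pi i\,n_kx_k/m_k)$ ($n\ge 0$) be the Vilenkin system. Let $\mathcal F_n$ be the $\sigma$-algebra generated by the sets $I_n(x)=\{y\in G_m: y_k=x_k \text{ for all } k<n\}$, $x\in G_m$. For $0<p<\infty$ the martingale Hardy space $H_p$ consists of all complex-valued martingales $f=(f^{(n)})_{n\ge 0}$ with respect to $(\mathcal F_n)$ such that $\|f\|_{H_p}:=\big\|\sup_n|f^{(n)}|\big\|_{L_p}<\infty$, and $\|F\|_{\text{weak-}L_p}:=\sup_{\lambda>0}\lambda\,\mu(|F|>\lambda)^{1/p}$. For a martingale $f$ let $\widehat f(i)=\lim_{k\to\infty}\int_{G_m}f^{(k)}\overline{\psi_i}\,d\mu$ and $S_nf=\sum_{k=0}^{n-1}\widehat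 f(k)\psi_k$. For a sequence $(q_k)_{k\ge0}$ of non-negative real numbers with $q_0>0$ let $Q_n=\sum_{k=0}^{n-1}q_k$ and $$T_nf=\frac1{Q_n}\sum_{k=0}^{n-1}q_kS_kf\quad(n\ge 1),\qquad T^*f=\sup_{n\ge 1}|T_nf| .$$ a) If $(q_k)_{k\ge 0}$ is non-decreasing, $q_0>0$, and $q_{n-1}/Q_n=O(1/n)$ as $n\to\infty$, then $T^*$ is bounded from $H_{1/2}$ to $\text{weak-}L_{1/2}$: there is a constant $C$ such that $\|T^*f\|_{\text{weak-}L_{1/2}}\le C\,\|f\|_{H_{1/2}}$ for all $f\in H_{1/2}$. b) For every $0<p<1/2$ and every non-decreasing sequence $(q_k)_{k\ge 0}$ with $q_0>0$ there is a martingale $f\in H_p$ such that $\sup_{n\ge 1}\|T_nf\|_{\text{weak-}L_p}=\infty$. -/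

import Mathlib

open MeasureTheory Filter Finset
open scoped ENNReal NNReal ComplexConjugate

/-- The Vilenkin group `G_m`, the complete direct product of the groups `ℤ/m_k`. -/
abbrev VilenkinGroup (m : ℕ → ℕ) : Type := (k : ℕ) → ZMod (m k)

namespace Vilenkin

noncomputable section

/-- The measure on `G_m`: the product of the measures `μ_k({j}) = 1/m_k` on `ℤ/m_k`
(all `m_k` are at least `2` where this is used). -/
def haar (m : ℕ → ℕ) : Measure (VilenkinGroup m) :=
  Measure.infinitePi fun k => ((m k : ℝ≥0∞)⁻¹ • Measure.count : Measure (ZMod (m k)))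

/-- The generalized number system `M_0 = 1`, `M_{k+1} = m_k M_k`. -/
def bigM (m : ℕ → ℕ) : ℕ → ℕ
  | 0 => 1
  | k + 1 => m k * bigM m k

/-- The `k`-th digit `n_k` in the expansion `n = ∑ n_k M_k`, `0 ≤ n_k < m_k`. -/
def digit (m : ℕ → ℕ) (n k : ℕ) : ℕ := n / bigM m k % m k

/-- The generalized Rademacher function `r_k(x) = exp(2 π i x_k / m_k)`, where `x_k` is
represented by an element of `{0, …, m_k - 1}`. -/
def rademacher (m : ℕ → ℕ) (k : ℕ) (x : VilenkinGroup m) : ℂ :=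
  Complex.exp (2 * Real.pi * Complex.I * ((x k).val : ℂ) / (m k : ℂ))

/-- The Vilenkin function `ψ_n = ∏_k r_k ^ n_k`. All factors with `k ≥ n` equal `1`, since
`n_k = 0` for `k ≥ n` (as `M_k ≥ 2 ^ k > n`), so the product is taken over `k < n`. -/
def psi (m : ℕ → ℕ) (n : ℕ) (x : VilenkinGroup m) : ℂ :=
  ∏ k ∈ range n, rademacher m k x ^ digit m n k

/-- The interval `I_n(x)`. -/
def interval (m : ℕ → ℕ) (n : ℕ) (x : VilenkinGroup m) : Set (VilenkinGroup m) :=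
  {y | ∀ k < n, y k = x k}

theorem countable_range_interval (m : ℕ → ℕ) (n : ℕ) : (Set.range (interval m n)).Countable := by
  have hc (k : ℕ) : Countable (ZMod (m k)) := by
    cases m k with
    | zero => exact inferInstanceAs (Countable ℤ)
    | succ j => exact inferInstanceAs (Countable (Fin (j + 1)))
  refine (Set.countable_range
    (fun a : ((k : Fin n) → ZMod (m k)) => {y : VilenkinGroup m | ∀ k : Fin n, y k = a k})).mono ?_
  rintro _ ⟨x, rfl⟩
  refine ⟨fun k => x k, ?_⟩
  ext y
  exact ⟨fun h k hk => h ⟨k, hk⟩, fun h k => h k k.2⟩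

theorem measurableSet_interval (m : ℕ → ℕ) (n : ℕ) (x : VilenkinGroup m) :
    MeasurableSet (interval m n x) := by
  have h : interval m n x = ⋂ k ∈ range n, (fun y : VilenkinGroup m => y k) ⁻¹' {x k} := by
    ext y; simp [interval]
  rw [h]
  exact Finset.measurableSet_biInter _ fun k _ =>
    measurable_pi_apply k (MeasurableSpace.measurableSet_top)

/-- The filtration of the σ-algebras `F_n`, generated by the intervals `I_n(x)`, `x ∈ G_m`. -/
def filtration (m : ℕ → ℕ) :
    Filtration ℕ (inferInstance : MeasurableSpace (VilenkinGroup m)) where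
  seq n := MeasurableSpace.generateFrom (Set.range (interval m n))
  mono' := by
    intro i j hij
    refine MeasurableSpace.generateFrom_le ?_
    rintro _ ⟨x, rfl⟩
    have h : interval m i x = ⋃₀ {s ∈ Set.range (interval m j) | s ⊆ interval m i x} := by
      refine Set.Subset.antisymm (fun y hy => ?_) (Set.sUnion_subset fun s hs => hs.2)
      exact ⟨interval m j y, ⟨⟨y, rfl⟩, fun z hz k hk =>
        (hz k (hk.trans_le hij)).trans (hy k hk)⟩, fun _ _ => rfl⟩
    rw [h]
    exact MeasurableSet.sUnion ((countable_range_interval m j).mono fun s hs => hs.1)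
      fun s hs => MeasurableSpace.measurableSet_generateFrom hs.1
  le' n := by
    refine MeasurableSpace.generateFrom_le ?_
    rintro _ ⟨x, rfl⟩
    exact measurableSet_interval m n x

/-- The maximal function `f^* = sup_n |f^(n)|`. -/
def maximalFunction (m : ℕ → ℕ) (f : ℕ → VilenkinGroup m → ℂ) (x : VilenkinGroup m) : ℝ≥0∞ :=
  ⨆ n, ‖f n x‖ₑ

/-- `‖f‖_{H_p} = ‖f^*‖_p`. -/
def hardyNorm (m : ℕ → ℕ) (p : ℝ) (f : ℕ → VilenkinGroup m → ℂ) : ℝ≥0∞ :=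
  (∫⁻ x, maximalFunction m f x ^ p ∂(haar m)) ^ (1 / p)

/-- The martingale Hardy space `H_p`: all (complex-valued) martingales `f = (f^(n))` with respect
to the σ-algebras `F_n` such that `‖f‖_{H_p} < ∞`. -/
def MemHardy (m : ℕ → ℕ) (p : ℝ) (f : ℕ → VilenkinGroup m → ℂ) : Prop :=
  Martingale f (filtration m) (haar m) ∧ hardyNorm m p f < ∞

/-- The quasi-norm `sup_{t > 0} t μ(F > t)^{1/p}` of `weak-L_p`, for a function `F ≥ 0`. -/
def weakNorm (m : ℕ → ℕ) (p : ℝ) (F : VilenkinGroup m → ℝ≥0∞) : ℝ≥0∞ :=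
  ⨆ (t : ℝ≥0) (_ : 0 < t), (t : ℝ≥0∞) * haar m {x | (t : ℝ≥0∞) < F x} ^ (1 / p)

/-- The Vilenkin-Fourier coefficient `lim_k ∫ f^(k) conj(ψ_i) dμ` of a martingale
(the sequence is eventually constant). -/
def coeff (m : ℕ → ℕ) (f : ℕ → VilenkinGroup m → ℂ) (i : ℕ) : ℂ :=
  limUnder atTop fun k => ∫ x, f k x * conj (psi m i x) ∂(haar m)

/-- The partial sum `S_n f = ∑_{k < n} c_k ψ_k` of the Vilenkin-Fourier series, where
`c_k` is the `k`-th Vilenkin-Fourier coefficient of `f`. -/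
def partialSum (m : ℕ → ℕ) (f : ℕ → VilenkinGroup m → ℂ) (n : ℕ) (x : VilenkinGroup m) : ℂ :=
  ∑ k ∈ range n, coeff m f k * psi m k x

/-- `Q_n = ∑_{k < n} q_k`. -/
def bigQ (q : ℕ → ℝ) (n : ℕ) : ℝ := ∑ k ∈ range n, q k

/-- The `T` mean `T_n f = (1 / Q_n) ∑_{k < n} q_k S_k f`, for `n ≥ 1` (and `T_0 f = 0`). -/
def tMean (m : ℕ → ℕ) (q : ℕ → ℝ) (f : ℕ → VilenkinGroup m → ℂ) (n : ℕ)
    (x : VilenkinGroup m) : ℂ :=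
  (1 / (bigQ q n : ℂ)) * ∑ k ∈ range n, (q k : ℂ) * partialSum m f k x

/-- The maximal operator `T^* f = sup_n |T_n f|` (the term `n = 0` is zero). -/
def tMax (m : ℕ → ℕ) (q : ℕ → ℝ) (f : ℕ → VilenkinGroup m → ℂ) (x : VilenkinGroup m) : ℝ≥0∞ :=
  ⨆ n, ‖tMean m q f n x‖ₑ

end

end Vilenkin

/-! Part a). Summation by parts against the non-decreasing weights bounds |T_n f| by 2 (n q_{n-1} /
Q_n) times the supremum over 1 ≤ j ≤ n of |∑_{k<j} S_k f| / j, so it suffices to treat the maximal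
operator of the Fejér means (`norm_tMean_le`). The Fejér kernels are dominated by sums of weights
M_n ∑_{t≤n} M_t 1_{cross t n}, where a cross is an interval with one coordinate set free
(`norm_fejer_le`). For an atom of height β on I_k(z) this bounds all Fejér means simultaneously by a
constant times β M_k^{-2} `totalWeight k z` (`norm_integral_mul_fejer_le`): orders n ≤ M_k are
killed outside I_k(z) by the mean value zero, and for larger n each further level contributes the
same amount, so that their number is absorbed by the division by n. The function `totalWeight k z`
lies in weak-L_{1/2}, uniformly in k and z (`measure_totalWeight_le`). To pass from atoms to f, the
martingale is stopped at the heights (s 2^j)^2, and the differences of consecutive stopped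
martingales are cut along the first hitting intervals into atoms (`eq_stopped_add_sum`). Because 1/2
< 1, the constants μ(F > r) √r of non-negative functions add up to a factor 3 (`measure_sum_gt_le`).
Their total is comparable with ∑_j s 2^j μ(f^* > (s 2^j)^2), hence bounded by the integral of
(f^*)^{1/2}. The lowest height s^2 is tied to the threshold under test, so the remaining bounded
part is harmless. Part b). Let f have the differences w_n M_n^{1/p} r_n 1_{I_n(0)}, with w supported
on a sparse sequence and ∑ w_n^p finite; then f is in H_p. Among S_0, …, S_{M_α+1} only the last
sees the atom at α, and it sees the single term ψ_{M_α}, whose modulus is constant on the whole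
group. As q is non-decreasing, this last partial sum has weight at least 1/(3 M_α) in the mean, so
T_{M_α+2} f has modulus at least w_α M_α^{1/p-2} / 3 everywhere, up to the contribution of earlier
atoms. For p < 1/2 the exponent is positive, and sparseness makes this term win
(`le_norm_tMean_atomSum`, `exists_sparse_sequence`). -/

namespace Vilenkin

noncomputable section

variable {m : ℕ → ℕ}

/-! ### The numbers `M_k` -/

instance neZero_of_fact [hm : Fact (∀ k, 2 ≤ m k)] (k : ℕ) : NeZero (m k) :=
  ⟨by have := hm.out k; omega⟩

theorem bigM_succ (k : ℕ) : bigM m (k + 1) = m k * bigM m k := rfl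

theorem bigM_eq_prod (k : ℕ) : bigM m k = ∏ i ∈ range k, m i := by
  induction k with
  | zero => rfl
  | succ k ih => rw [prod_range_succ, bigM_succ, ih, mul_comm]

theorem bigM_dvd {i j : ℕ} (h : i ≤ j) : bigM m i ∣ bigM m j := by
  rw [bigM_eq_prod, bigM_eq_prod]
  exact prod_dvd_prod_of_subset _ _ _ (range_subset_range.2 h)

section

variable [hm : Fact (∀ k, 2 ≤ m k)]

theorem bigM_pos (k : ℕ) : 0 < bigM m k := by
  rw [bigM_eq_prod]
  exact prod_pos fun i _ => Nat.pos_of_neZero _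

theorem bigM_cast_pos (k : ℕ) : (0 : ℝ) < bigM m k := by exact_mod_cast bigM_pos k

theorem one_le_bigM (k : ℕ) : (1 : ℝ) ≤ bigM m k := by exact_mod_cast bigM_pos k

theorem two_mul_bigM_le (k : ℕ) : 2 * bigM m k ≤ bigM m (k + 1) :=
  Nat.mul_le_mul_right _ (hm.out k)

theorem bigM_mono : Monotone (bigM m) := fun _ _ h => Nat.le_of_dvd (bigM_pos _) (bigM_dvd h)

theorem bigM_cast_mono {i j : ℕ} (h : i ≤ j) : (bigM m i : ℝ) ≤ bigM m j := by
  exact_mod_cast bigM_mono h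

theorem two_pow_mul_bigM_le (k j : ℕ) : 2 ^ j * bigM m k ≤ bigM m (k + j) := by
  induction j with
  | zero => simp
  | succ j ih =>
    calc 2 ^ (j + 1) * bigM m k = 2 * (2 ^ j * bigM m k) := by ring
      _ ≤ 2 * bigM m (k + j) := by gcongr
      _ ≤ _ := two_mul_bigM_le _

theorem lt_bigM (k : ℕ) : k < bigM m k := by
  have := two_pow_mul_bigM_le (m := m) 0 k
  simp only [bigM, mul_one, zero_add] at this
  exact lt_of_lt_of_le Nat.lt_two_pow_self this

/-- A geometric sum of the `M_k` is dominated by its last term. -/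
theorem sum_bigM_le (n : ℕ) : ∑ k ∈ range (n + 1), (bigM m k : ℝ) ≤ 2 * bigM m n := by
  induction n with
  | zero => simp [bigM]
  | succ n ih =>
    rw [sum_range_succ]
    have : (2 * bigM m n : ℝ) ≤ bigM m (n + 1) := by exact_mod_cast two_mul_bigM_le n
    linarith

theorem exists_bigM_le {n : ℕ} (hn : 1 ≤ n) : ∃ a, bigM m a ≤ n ∧ n < bigM m (a + 1) := by
  have hex : ∃ k, n < bigM m k := ⟨n, lt_bigM n⟩
  classical
  obtain ⟨k, hk⟩ : ∃ k, Nat.find hex = k + 1 := by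
    refine Nat.exists_eq_succ_of_ne_zero fun h => ?_
    have := Nat.find_spec hex
    rw [h] at this
    simp only [bigM] at this
    omega
  exact ⟨k, not_lt.1 (Nat.find_min hex (by omega)), hk ▸ Nat.find_spec hex⟩

end

/-! ### Boxes and their measure -/

/-- The set of points that agree with `x` in the coordinates from `s`. -/
def box (s : Finset ℕ) (x : VilenkinGroup m) : Set (VilenkinGroup m) := {y | ∀ k ∈ s, y k = x k}

theorem interval_eq_box (n : ℕ) (x : VilenkinGroup m) : interval m n x = box (range n) x := by
  ext; simp [interval, box]

theorem box_subset {s t : Finset ℕ} (h : s ⊆ t) (x : VilenkinGroup m) : box t x ⊆ box s x :=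
  fun _ hy k hk => hy k (h hk)

theorem box_eq_pi (s : Finset ℕ) (x : VilenkinGroup m) :
    box s x = Set.pi (s : Set ℕ) fun k => {x k} := by
  ext; simp [box, Set.mem_pi]

theorem measurableSet_box (s : Finset ℕ) (x : VilenkinGroup m) : MeasurableSet (box s x) := by
  rw [box_eq_pi]
  exact MeasurableSet.pi s.countable_toSet fun k _ => MeasurableSpace.measurableSet_top

theorem self_mem_interval (n : ℕ) (x : VilenkinGroup m) : x ∈ interval m n x := fun _ _ => rfl

theorem interval_comm {n : ℕ} {x y : VilenkinGroup m} :
    y ∈ interval m n x ↔ x ∈ interval m n y :=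
  ⟨fun h k hk => (h k hk).symm, fun h k hk => (h k hk).symm⟩

theorem interval_trans {n : ℕ} {x y z : VilenkinGroup m} (h₁ : y ∈ interval m n x)
    (h₂ : z ∈ interval m n y) : z ∈ interval m n x := fun k hk => (h₂ k hk).trans (h₁ k hk)

theorem interval_anti {i j : ℕ} (h : i ≤ j) (x : VilenkinGroup m) :
    interval m j x ⊆ interval m i x := fun _ hy k hk => hy k (hk.trans_le h)

section

variable [hm : Fact (∀ k, 2 ≤ m k)]

instance isProbabilityMeasure_factor (k : ℕ) :
    IsProbabilityMeasure ((m k : ℝ≥0∞)⁻¹ • Measure.count : Measure (ZMod (m k))) := by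
  constructor
  have h : (Measure.count (Set.univ : Set (ZMod (m k)))) = (m k : ℝ≥0∞) := by
    rw [← Finset.coe_univ, Measure.count_apply_finset' MeasurableSpace.measurableSet_top]
    simp [ZMod.card]
  rw [Measure.smul_apply, h, smul_eq_mul]
  exact ENNReal.inv_mul_cancel (by exact_mod_cast NeZero.ne (m k)) (ENNReal.natCast_ne_top _)

instance isProbabilityMeasure_haar : IsProbabilityMeasure (haar m) := by
  unfold haar; infer_instance

theorem haar_box (s : Finset ℕ) (x : VilenkinGroup m) :
    (haar m).real (box s x) = ∏ k ∈ s, (m k : ℝ)⁻¹ := by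
  have h1 (k : ℕ) : ((m k : ℝ≥0∞)⁻¹ • Measure.count : Measure (ZMod (m k))) {x k}
      = (m k : ℝ≥0∞)⁻¹ := by
    rw [Measure.smul_apply, Measure.count_singleton' MeasurableSpace.measurableSet_top]; simp
  rw [measureReal_def, box_eq_pi, haar,
    Measure.infinitePi_pi _ fun k _ => MeasurableSpace.measurableSet_top]
  simp [h1, ENNReal.toReal_prod]

theorem haar_interval (n : ℕ) (x : VilenkinGroup m) :
    (haar m).real (interval m n x) = (bigM m n : ℝ)⁻¹ := by
  rw [interval_eq_box, haar_box, bigM_eq_prod]; simp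

/-- Freeing one coordinate multiplies the measure of an interval by m_t ≤ B. -/
theorem haar_box_erase_le {B : ℕ} (hB : ∀ k, m k ≤ B) (t n : ℕ) (x : VilenkinGroup m) :
    (haar m).real (box ((range n).erase t) x) ≤ B * (bigM m n : ℝ)⁻¹ := by
  have hB1 : (1 : ℝ) ≤ B := by exact_mod_cast le_trans (Nat.pos_of_neZero (m 0)) (hB 0)
  have hpos : (0 : ℝ) ≤ (bigM m n : ℝ)⁻¹ := by positivity
  have hcast : (bigM m n : ℝ)⁻¹ = ∏ i ∈ range n, (m i : ℝ)⁻¹ := by rw [bigM_eq_prod]; simp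
  rw [haar_box]
  by_cases ht : t ∈ range n
  · rw [hcast, ← mul_prod_erase _ _ ht, ← mul_assoc]
    refine le_mul_of_one_le_left (by positivity) ?_
    have : (0 : ℝ) < m t := by exact_mod_cast Nat.pos_of_neZero (m t)
    rw [← div_eq_mul_inv, one_le_div this]
    exact_mod_cast hB t
  · rw [erase_eq_of_notMem ht, ← hcast]
    exact le_mul_of_one_le_left hpos hB1

end

/-! ### Functions that depend on finitely many coordinates -/

/-- The function `g` depends on the first `n` coordinates only. -/
def AtLevel {β : Type*} (n : ℕ) (g : VilenkinGroup m → β) : Prop :=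
  ∀ x, ∀ y ∈ interval m n x, g y = g x

theorem AtLevel.mono {β : Type*} {i j : ℕ} {g : VilenkinGroup m → β} (hg : AtLevel i g)
    (h : i ≤ j) : AtLevel j g := fun x y hy => hg x y (interval_anti h x hy)

theorem atLevel_const {β : Type*} (n : ℕ) (c : β) : AtLevel n fun _ : VilenkinGroup m => c :=
  fun _ _ _ => rfl

theorem AtLevel.comp {β γ : Type*} {n : ℕ} {g : VilenkinGroup m → β} (hg : AtLevel n g)
    (φ : β → γ) : AtLevel n fun x => φ (g x) := fun x y hy => congrArg φ (hg x y hy)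

theorem AtLevel.comp₂ {β γ δ : Type*} {n : ℕ} {g : VilenkinGroup m → β} {h : VilenkinGroup m → γ}
    (hg : AtLevel n g) (hh : AtLevel n h) (φ : β → γ → δ) :
    AtLevel n fun x => φ (g x) (h x) := fun x y hy => by
  simp only [hg x y hy, hh x y hy]

theorem AtLevel.sum {ι : Type*} {n : ℕ} {s : Finset ι} {g : ι → VilenkinGroup m → ℂ}
    (hg : ∀ i ∈ s, AtLevel n (g i)) : AtLevel n fun x => ∑ i ∈ s, g i x :=
  fun x y hy => sum_congr rfl fun i hi => hg i hi x y hy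

theorem AtLevel.prod {ι : Type*} {n : ℕ} {s : Finset ι} {g : ι → VilenkinGroup m → ℂ}
    (hg : ∀ i ∈ s, AtLevel n (g i)) : AtLevel n fun x => ∏ i ∈ s, g i x :=
  fun x y hy => prod_congr rfl fun i hi => hg i hi x y hy

theorem atLevel_mem_interval {k n : ℕ} (h : k ≤ n) (z : VilenkinGroup m) :
    AtLevel n fun x => x ∈ interval m k z := fun x y hy => by
  have hy' := interval_anti h x hy
  exact propext ⟨fun h => interval_trans h (interval_comm.1 hy'), fun h => interval_trans h hy'⟩

theorem atLevel_mem_box {s : Finset ℕ} {n : ℕ} (h : s ⊆ range n) (z : VilenkinGroup m) :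
    AtLevel n fun x => x ∈ box s z := fun x y hy => by
  refine propext (forall₂_congr fun k hk => ?_)
  rw [hy k (mem_range.1 (h hk))]

/-- The point with the coordinates of `x` below `n`, and `0` from `n` on. -/
def trunc (n : ℕ) (x : VilenkinGroup m) : VilenkinGroup m := fun k => if k < n then x k else 0

theorem trunc_mem (n : ℕ) (x : VilenkinGroup m) : trunc n x ∈ interval m n x :=
  fun k hk => by simp [trunc, hk]

theorem trunc_eq_of_mem {n : ℕ} {x y : VilenkinGroup m} (h : y ∈ interval m n x) :
    trunc n y = trunc n x := by
  ext k
  by_cases hk : k < n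
  · simp [trunc, hk, h k hk]
  · simp [trunc, hk]

theorem trunc_trunc_of_le {i j : ℕ} (h : i ≤ j) (x : VilenkinGroup m) :
    trunc j (trunc i x) = trunc i x := by
  ext k
  by_cases hk : k < i
  · simp [trunc, hk, hk.trans_le h]
  · simp [trunc, hk]

/-- Sets of `F_n` are unions of intervals `I_n(x)`. -/
theorem atLevel_of_measurableSet {n : ℕ} {s : Set (VilenkinGroup m)}
    (hs : MeasurableSet[filtration m n] s) : AtLevel n fun x => x ∈ s := by
  induction s, hs using MeasurableSpace.generateFrom_induction with
  | hC s hs _ =>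
    obtain ⟨z, rfl⟩ := hs
    exact atLevel_mem_interval le_rfl z
  | empty => exact atLevel_const n False
  | compl s _ ih => exact ih.comp Not
  | iUnion s _ ih =>
    intro x y hy
    simp only [Set.mem_iUnion]
    exact propext (exists_congr fun i => iff_of_eq (ih i x y hy))

/-- The level set of g through x belongs to F_n, hence contains I_n(x). -/
theorem atLevel_of_measurable {n : ℕ} {g : VilenkinGroup m → ℂ}
    (hg : Measurable[filtration m n] g) : AtLevel n g := fun x y hy => by
  have h := atLevel_of_measurableSet (hg (measurableSet_singleton (g x))) x y hy
  simpa using h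

section

variable [hm : Fact (∀ k, 2 ≤ m k)]

theorem finite_range_trunc (n : ℕ) : (Set.range (trunc (m := m) n)).Finite := by
  refine (Set.finite_range fun a : ((k : Fin n) → ZMod (m k)) =>
    (fun k => if h : k < n then a ⟨k, h⟩ else 0 : VilenkinGroup m)).subset ?_
  rintro _ ⟨x, rfl⟩
  refine ⟨fun k => x k, ?_⟩
  ext k
  by_cases hk : k < n <;> simp [trunc, hk]

/-- Representatives of the intervals `I_n(x)`. -/
def reps (m : ℕ → ℕ) [Fact (∀ k, 2 ≤ m k)] (n : ℕ) : Finset (VilenkinGroup m) :=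
  (finite_range_trunc n).toFinset

theorem mem_reps {n : ℕ} {z : VilenkinGroup m} : z ∈ reps m n ↔ trunc n z = z := by
  simp only [reps, Set.Finite.mem_toFinset, Set.mem_range]
  exact ⟨fun ⟨x, hx⟩ => by rw [← hx, trunc_trunc_of_le le_rfl], fun h => ⟨z, h⟩⟩

theorem trunc_mem_reps (n : ℕ) (x : VilenkinGroup m) : trunc n x ∈ reps m n :=
  mem_reps.2 (trunc_trunc_of_le le_rfl x)

theorem iUnion_reps (n : ℕ) : ⋃ z ∈ reps m n, interval m n z = Set.univ :=
  Set.eq_univ_of_forall fun x => Set.mem_iUnion₂.2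
    ⟨trunc n x, trunc_mem_reps n x, interval_comm.1 (trunc_mem n x)⟩

theorem eq_trunc_of_mem {n : ℕ} {x z : VilenkinGroup m} (hz : z ∈ reps m n)
    (h : x ∈ interval m n z) : z = trunc n x := by
  rw [trunc_eq_of_mem h, mem_reps.1 hz]

theorem pairwiseDisjoint_reps (n : ℕ) :
    (reps m n : Set (VilenkinGroup m)).PairwiseDisjoint (interval m n) := by
  intro z hz w hw hne
  refine Set.disjoint_left.2 fun x hx hx' => hne ?_
  rw [eq_trunc_of_mem hz hx, eq_trunc_of_mem hw hx']

theorem AtLevel.finite_range {β : Type*} {n : ℕ} {g : VilenkinGroup m → β} (hg : AtLevel n g) :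
    (Set.range g).Finite := by
  refine ((finite_range_trunc (m := m) n).image g).subset ?_
  rintro _ ⟨x, rfl⟩
  exact ⟨trunc n x, ⟨x, rfl⟩, hg x _ (trunc_mem n x)⟩

theorem AtLevel.preimage_eq {β : Type*} {n : ℕ} {g : VilenkinGroup m → β} (hg : AtLevel n g)
    (s : Set β) : g ⁻¹' s = ⋃ z ∈ {z ∈ (reps m n : Set (VilenkinGroup m)) | g z ∈ s},
      interval m n z := by
  ext x
  simp only [Set.mem_preimage, Set.mem_ofPred_eq, Set.mem_iUnion, exists_prop, SetLike.mem_coe]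
  constructor
  · intro h
    exact ⟨trunc n x, ⟨trunc_mem_reps n x, by rwa [hg x _ (trunc_mem n x)]⟩,
      interval_comm.1 (trunc_mem n x)⟩
  · rintro ⟨z, ⟨-, h⟩, hx⟩
    rwa [hg z x hx]

theorem AtLevel.measurable_filtration {β : Type*} [MeasurableSpace β] {n : ℕ}
    {g : VilenkinGroup m → β} (hg : AtLevel n g) : Measurable[filtration m n] g := by
  intro s _
  rw [hg.preimage_eq s]
  exact MeasurableSet.biUnion ((reps m n).finite_toSet.subset fun z hz => hz.1).countable
    fun z _ => MeasurableSpace.measurableSet_generateFrom ⟨z, rfl⟩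

theorem AtLevel.measurable {β : Type*} [MeasurableSpace β] {n : ℕ} {g : VilenkinGroup m → β}
    (hg : AtLevel n g) : Measurable g :=
  hg.measurable_filtration.mono ((filtration m).le n) le_rfl

theorem AtLevel.measurableSet {n : ℕ} {s : Set (VilenkinGroup m)}
    (hs : AtLevel n fun x => x ∈ s) : MeasurableSet s := hs.measurable.setOf

theorem AtLevel.exists_bound {n : ℕ} {g : VilenkinGroup m → ℂ} (hg : AtLevel n g) :
    ∃ C, ∀ x, ‖g x‖ ≤ C := by
  obtain ⟨C, hC⟩ := (hg.finite_range.image norm).bddAbove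
  exact ⟨C, fun x => hC ⟨g x, ⟨x, rfl⟩, rfl⟩⟩

theorem AtLevel.integrable {n : ℕ} {g : VilenkinGroup m → ℂ} (hg : AtLevel n g) :
    Integrable g (haar m) := by
  obtain ⟨C, hC⟩ := hg.exists_bound
  exact Integrable.of_bound hg.measurable.aestronglyMeasurable C (ae_of_all _ hC)

theorem AtLevel.integrable_real {n : ℕ} {g : VilenkinGroup m → ℝ} (hg : AtLevel n g) :
    Integrable g (haar m) := by
  obtain ⟨C, hC⟩ := (hg.comp (fun r : ℝ => (r : ℂ))).exists_bound
  exact Integrable.of_bound hg.measurable.aestronglyMeasurable C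
    (ae_of_all _ fun x => by simpa using hC x)

/-- Integrals of multiples of functions of mean zero on all intervals of level `n`. -/
theorem integral_mul_eq_zero {n : ℕ} {u h : VilenkinGroup m → ℂ} (hu : Integrable u (haar m))
    (h0 : ∀ z, ∫ x in interval m n z, u x ∂(haar m) = 0) (hh : AtLevel n h) :
    ∫ x, u x * h x ∂(haar m) = 0 := by
  obtain ⟨C, hC⟩ := hh.exists_bound
  have hint : Integrable (fun x => u x * h x) (haar m) :=
    hu.mul_bdd (c := C) hh.measurable.aestronglyMeasurable (ae_of_all _ hC)
  rw [← setIntegral_univ, ← iUnion_reps n,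
    integral_biUnion_finset _ (fun z _ => measurableSet_interval m n z) (pairwiseDisjoint_reps n)
      fun z _ => hint.integrableOn]
  refine sum_eq_zero fun z _ => ?_
  rw [setIntegral_congr_fun (measurableSet_interval m n z) (g := fun x => u x * h z)
    fun x hx => by simp only [hh z x hx]]
  rw [integral_mul_const, h0 z, zero_mul]

end
set_option linter.unusedSectionVars false

variable [hm : Fact (∀ k, 2 ≤ m k)]

/-! ### The Vilenkin system -/

theorem rademacher_eq_pow (k : ℕ) (x : VilenkinGroup m) :
    rademacher m k x = Complex.exp (2 * Real.pi * Complex.I / m k) ^ (x k).val := by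
  rw [rademacher, ← Complex.exp_nat_mul]
  congr 1
  ring

theorem norm_rademacher (k : ℕ) (x : VilenkinGroup m) : ‖rademacher m k x‖ = 1 := by
  rw [rademacher_eq_pow, norm_pow,
    (Complex.isPrimitiveRoot_exp _ (NeZero.ne (m k))).norm'_eq_one (NeZero.ne (m k)), one_pow]

theorem rademacher_mul_conj_self (k : ℕ) (x : VilenkinGroup m) :
    rademacher m k x * conj (rademacher m k x) = 1 := by
  rw [Complex.mul_conj, Complex.normSq_eq_norm_sq, norm_rademacher]; simp

theorem rademacher_pow_card (k : ℕ) (x : VilenkinGroup m) : rademacher m k x ^ m k = 1 := by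
  rw [rademacher_eq_pow, ← pow_mul, mul_comm (x k).val, pow_mul,
    (Complex.isPrimitiveRoot_exp _ (NeZero.ne (m k))).pow_eq_one, one_pow]

theorem rademacher_inj {k : ℕ} {x y : VilenkinGroup m}
    (h : rademacher m k x = rademacher m k y) : x k = y k := by
  rw [rademacher_eq_pow, rademacher_eq_pow] at h
  exact ZMod.val_injective _ ((Complex.isPrimitiveRoot_exp _ (NeZero.ne (m k))).pow_inj
    (ZMod.val_lt _) (ZMod.val_lt _) h)

theorem sum_pow_of_pow_eq_one {n : ℕ} {w : ℂ} (hw : w ^ n = 1) (h1 : w ≠ 1) :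
    ∑ t ∈ range n, w ^ t = 0 := by
  have h := geom_sum_mul w n
  rw [hw, sub_self] at h
  exact (mul_eq_zero.1 h).resolve_right (sub_ne_zero.2 h1)

theorem atLevel_rademacher {k n : ℕ} (h : k < n) : AtLevel n (rademacher m k) :=
  fun x y hy => by simp only [rademacher, hy k h]

theorem digit_eq_zero {n k : ℕ} (h : n < bigM m k) : digit m n k = 0 := by
  rw [digit, Nat.div_eq_of_lt h, Nat.zero_mod]

theorem psi_eq_prod {n K : ℕ} (h : n < bigM m K) (x : VilenkinGroup m) :
    psi m n x = ∏ k ∈ range K, rademacher m k x ^ digit m n k := by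
  have aux (a b : ℕ) (hab : a ≤ b) (ha : n < bigM m a) :
      ∏ k ∈ range a, rademacher m k x ^ digit m n k
        = ∏ k ∈ range b, rademacher m k x ^ digit m n k := by
    refine prod_subset (range_subset_range.2 hab) fun k _ hk => ?_
    rw [digit_eq_zero (ha.trans_le (bigM_mono (by simpa using hk))), pow_zero]
  rcases le_total n K with hK | hK
  · exact aux _ _ hK (lt_bigM n)
  · exact (aux _ _ hK h).symm

theorem atLevel_psi {n K : ℕ} (h : n < bigM m K) : AtLevel K (psi m n) := by
  have : psi m n = fun x => ∏ k ∈ range K, rademacher m k x ^ digit m n k :=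
    funext (psi_eq_prod h)
  rw [this]
  exact AtLevel.prod fun i hi => (atLevel_rademacher (mem_range.1 hi)).comp (· ^ digit m n i)

theorem norm_psi (n : ℕ) (x : VilenkinGroup m) : ‖psi m n x‖ = 1 := by
  simp [psi, norm_prod, norm_rademacher]

/-- Adding s M_A to l < M_A leaves the digits below A alone and sets the digit A to s. All kernel
recursions below come from this factorization. -/
theorem psi_add {A s l : ℕ} (hs : s < m A) (hl : l < bigM m A) (x : VilenkinGroup m) :
    psi m (s * bigM m A + l) x = rademacher m A x ^ s * psi m l x := by
  have hlt : s * bigM m A + l < bigM m (A + 1) := by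
    rw [bigM_succ]
    calc s * bigM m A + l < s * bigM m A + bigM m A := by omega
      _ = (s + 1) * bigM m A := by ring
      _ ≤ _ := Nat.mul_le_mul_right _ hs
  rw [psi_eq_prod hlt, psi_eq_prod hl, prod_range_succ, mul_comm]
  congr 1
  · congr 1
    rw [digit, add_comm, Nat.add_mul_div_right _ _ (bigM_pos A), Nat.div_eq_of_lt hl, zero_add,
      Nat.mod_eq_of_lt hs]
  · refine prod_congr rfl fun k hk => ?_
    -- Since M_{k+1} divides M_A, the number s M_A / M_k is a multiple of m_k and does not affect
    -- the digit k.
    obtain ⟨c, hc⟩ := bigM_dvd (m := m) (Nat.succ_le_of_lt (mem_range.1 hk))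
    congr 1
    rw [digit, digit, hc, Nat.succ_eq_add_one, bigM_succ]
    rw [show s * (m k * bigM m k * c) + l = l + s * c * m k * bigM m k by ring,
      Nat.add_mul_div_right _ _ (bigM_pos k), Nat.add_mul_mod_self_right]

/-! ### Mean values of powers of the Rademacher functions -/

theorem sum_zmod_eq_sum_range {n : ℕ} [NeZero n] (φ : ℕ → ℂ) :
    ∑ a : ZMod n, φ a.val = ∑ i ∈ range n, φ i := by
  refine sum_bij (fun a _ => a.val) (fun a _ => mem_range.2 (ZMod.val_lt a))
    (fun a _ b _ h => ZMod.val_injective _ h)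
    (fun i hi => ⟨(i : ZMod n), mem_univ _, ZMod.val_cast_of_lt (mem_range.1 hi)⟩)
    fun _ _ => rfl

theorem update_mem_interval (n : ℕ) (z : VilenkinGroup m) (a : ZMod (m n)) :
    Function.update z n a ∈ interval m n z :=
  fun _ hk => Function.update_of_ne hk.ne _ _

/-- I_A(z) splits into m_A intervals of equal measure on which r_A runs through all m_A-th roots of
unity. For 0 < s < m_A the sum of their s-th powers is a vanishing geometric sum. -/
theorem setIntegral_rademacher_pow {A s : ℕ} (h0 : 0 < s) (hs : s < m A) (z : VilenkinGroup m) :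
    ∫ x in interval m A z, rademacher m A x ^ s ∂(haar m) = 0 := by
  have hunion : interval m A z
      = ⋃ a ∈ (univ : Finset (ZMod (m A))), interval m (A + 1) (Function.update z A a) := by
    ext x
    simp only [mem_univ, Set.iUnion_true, Set.mem_iUnion]
    constructor
    · intro hx
      refine ⟨x A, fun k hk => ?_⟩
      rcases Nat.lt_succ_iff_lt_or_eq.1 hk with h | rfl
      · rw [Function.update_of_ne h.ne, hx k h]
      · rw [Function.update_self]
    · rintro ⟨a, ha⟩
      exact interval_trans (update_mem_interval A z a) (interval_anti (Nat.le_succ A) _ ha)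
  have hlev : AtLevel (A + 1) fun x => rademacher m A x ^ s :=
    (atLevel_rademacher (Nat.lt_succ_self A)).comp (· ^ s)
  rw [hunion, integral_biUnion_finset _ (fun z _ => measurableSet_interval m _ _) _
    fun z _ => hlev.integrable.integrableOn]
  · have h1 (a : ZMod (m A)) :
        ∫ x in interval m (A + 1) (Function.update z A a), rademacher m A x ^ s ∂(haar m)
          = (bigM m (A + 1) : ℝ)⁻¹ •
            (Complex.exp (2 * Real.pi * Complex.I / m A) ^ s) ^ a.val := by
      rw [setIntegral_congr_fun (measurableSet_interval m _ _) fun x hx => hlev _ x hx,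
        setIntegral_const, haar_interval]
      simp only
      rw [rademacher_eq_pow, Function.update_self, ← pow_mul, ← pow_mul, mul_comm s]
    simp_rw [h1]
    rw [← smul_sum, sum_zmod_eq_sum_range (fun i => (Complex.exp _ ^ s) ^ i),
      sum_pow_of_pow_eq_one, smul_zero]
    · rw [← pow_mul, mul_comm s, pow_mul,
        (Complex.isPrimitiveRoot_exp _ (NeZero.ne (m A))).pow_eq_one, one_pow]
    · exact (Complex.isPrimitiveRoot_exp _ (NeZero.ne (m A))).pow_ne_one_of_pos_of_lt h0.ne' hs
  · intro a _ b _ hab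
    refine Set.disjoint_left.2 fun x hx hx' => hab ?_
    have h1 := hx A (Nat.lt_succ_self A)
    have h2 := hx' A (Nat.lt_succ_self A)
    rw [Function.update_self] at h1 h2
    exact h1.symm.trans h2

/-- A function that depends on the first `A` coordinates is orthogonal to `ψ_i` for
`i ≥ M_A`. -/
theorem integral_mul_conj_psi_eq_zero {A i : ℕ} (hi : bigM m A ≤ i) {g : VilenkinGroup m → ℂ}
    (hg : AtLevel A g) : ∫ x, g x * conj (psi m i x) ∂(haar m) = 0 := by
  obtain ⟨a, ha, ha'⟩ := exists_bigM_le (m := m) ((bigM_pos A).trans_le hi)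
  have hAa : A ≤ a := by
    by_contra h
    exact absurd (ha'.trans_le (bigM_mono (m := m) (show a + 1 ≤ A by omega))) (not_lt.2 hi)
  have hs : i / bigM m a < m a := (Nat.div_lt_iff_lt_mul (bigM_pos a)).2 ha'
  have hpos : 0 < i / bigM m a := Nat.div_pos ha (bigM_pos a)
  have hl := Nat.mod_lt i (bigM_pos (m := m) a)
  have hψ (x : VilenkinGroup m) :
      psi m i x = rademacher m a x ^ (i / bigM m a) * psi m (i % bigM m a) x := by
    conv_lhs => rw [← Nat.div_add_mod' i (bigM m a)]
    exact psi_add hs hl x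
  -- The leading digit of i contributes r_a^s with s > 0, which has mean zero on the intervals of
  -- level a; the other factors depend on the first a coordinates only.
  have key := integral_mul_eq_zero (n := a)
    (((atLevel_rademacher (m := m) (Nat.lt_succ_self a)).comp (· ^ (i / bigM m a))).integrable)
    (fun z => setIntegral_rademacher_pow hpos hs z)
    ((hg.mono hAa).comp₂ (atLevel_psi hl) fun u v => conj u * v)
  have := congrArg conj key
  rw [← integral_conj, map_zero] at this
  rw [← this]
  refine integral_congr_ae (ae_of_all _ fun x => ?_)
  simp only [hψ, map_mul, Complex.conj_conj]
  ring

/-! ### The Dirichlet and Fejér kernels -/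

/-- The Dirichlet kernel `∑_{i < n} ψ_i(x) conj ψ_i(y)`. -/
def dirichlet (n : ℕ) (x y : VilenkinGroup m) : ℂ := ∑ i ∈ range n, psi m i x * conj (psi m i y)

/-- The sum of the first `n` Dirichlet kernels. -/
def fejer (n : ℕ) (x y : VilenkinGroup m) : ℂ := ∑ k ∈ range n, dirichlet k x y

/-- The value `r_k(x) conj r_k(y)`. -/
def rho (k : ℕ) (x y : VilenkinGroup m) : ℂ := rademacher m k x * conj (rademacher m k y)

theorem norm_rho (k : ℕ) (x y : VilenkinGroup m) : ‖rho k x y‖ = 1 := by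
  simp [rho, norm_rademacher]

theorem sum_rho_pow (k : ℕ) (x y : VilenkinGroup m) :
    ∑ t ∈ range (m k), rho k x y ^ t = if y k = x k then (m k : ℂ) else 0 := by
  split_ifs with h
  · have : rho k x y = 1 := by
      rw [rho, ← rademacher_mul_conj_self k x]
      simp only [rademacher, h]
    simp [this]
  · refine sum_pow_of_pow_eq_one ?_ fun h1 => h ?_
    · rw [rho, mul_pow, ← map_pow, rademacher_pow_card, rademacher_pow_card]; simp
    · refine (rademacher_inj ?_).symm
      have := congrArg (· * rademacher m k y) h1
      simp only [rho, one_mul] at this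
      rwa [mul_assoc, mul_comm (conj _), rademacher_mul_conj_self, mul_one] at this

theorem dirichlet_add {A s l : ℕ} (hs : s < m A) (hl : l ≤ bigM m A) (x y : VilenkinGroup m) :
    dirichlet (s * bigM m A + l) x y
      = dirichlet (s * bigM m A) x y + rho A x y ^ s * dirichlet l x y := by
  rw [dirichlet, sum_range_add, dirichlet, dirichlet, mul_sum]
  congr 1
  refine sum_congr rfl fun i hi => ?_
  have hi' := (mem_range.1 hi).trans_le hl
  rw [psi_add hs hi', psi_add hs hi', rho, map_mul, map_pow, mul_pow]
  ring

theorem dirichlet_mul {A s : ℕ} (hs : s ≤ m A) (x y : VilenkinGroup m) :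
    dirichlet (s * bigM m A) x y = (∑ t ∈ range s, rho A x y ^ t) * dirichlet (bigM m A) x y := by
  induction s with
  | zero => simp [dirichlet]
  | succ s ih =>
    rw [add_mul, one_mul, dirichlet_add (by omega) le_rfl, ih (by omega), sum_range_succ]
    ring

/-- Induction on A: the full sum of powers of `rho A x y` is m_A or 0 according to whether the
coordinates A agree, so each step refines the interval by one coordinate. -/
theorem dirichlet_bigM (A : ℕ) (x y : VilenkinGroup m) :
    dirichlet (bigM m A) x y = (interval m A x).indicator (fun _ => (bigM m A : ℂ)) y := by
  induction A with
  | zero =>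
    have h : y ∈ interval m 0 x := fun k hk => absurd hk (by omega)
    simp [Set.indicator_of_mem h, bigM, dirichlet, psi]
  | succ A ih =>
    rw [bigM_succ, dirichlet_mul le_rfl, ih, sum_rho_pow]
    have hiff : y ∈ interval m (A + 1) x ↔ y ∈ interval m A x ∧ y A = x A := by
      constructor
      · exact fun h => ⟨interval_anti (Nat.le_succ A) x h, h A (Nat.lt_succ_self A)⟩
      · rintro ⟨h, h'⟩ k hk
        rcases Nat.lt_succ_iff_lt_or_eq.1 hk with hk | rfl
        exacts [h k hk, h']
    by_cases h1 : y ∈ interval m A x <;> by_cases h2 : y A = x A <;>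
      simp [Set.indicator, hiff, h1, h2]

theorem atLevel_dirichlet {n K : ℕ} (h : n ≤ bigM m K) (x : VilenkinGroup m) :
    AtLevel K (dirichlet n x) :=
  AtLevel.sum fun i hi => (atLevel_psi ((mem_range.1 hi).trans_le h)).comp
    fun w => psi m i x * conj w

theorem atLevel_fejer {n K : ℕ} (h : n ≤ bigM m K) (x : VilenkinGroup m) :
    AtLevel K (fejer n x) :=
  AtLevel.sum fun _ hi => atLevel_dirichlet ((mem_range.1 hi).le.trans h) x

/-- Each of the last l Dirichlet kernels contains the block D_{s M_A}, whence the factor l; the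
remainders are D_0, …, D_{l-1} modulated by `rho A x y ^ s`. -/
theorem fejer_add {A s l : ℕ} (hs : s < m A) (hl : l ≤ bigM m A) (x y : VilenkinGroup m) :
    fejer (s * bigM m A + l) x y
      = fejer (s * bigM m A) x y + l * dirichlet (s * bigM m A) x y
        + rho A x y ^ s * fejer l x y := by
  rw [fejer, sum_range_add, fejer, fejer, mul_sum, add_assoc]
  congr 1
  rw [sum_congr rfl fun k hk => dirichlet_add hs ((mem_range.1 hk).le.trans hl) x y,
    sum_add_distrib, sum_const, card_range, nsmul_eq_mul]

theorem fejer_mul {A s : ℕ} (hs : s ≤ m A) (x y : VilenkinGroup m) :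
    fejer (s * bigM m A) x y
      = bigM m A * ∑ t ∈ range s, dirichlet (t * bigM m A) x y
        + (∑ t ∈ range s, rho A x y ^ t) * fejer (bigM m A) x y := by
  induction s with
  | zero => simp [fejer]
  | succ s ih =>
    rw [add_mul, one_mul, fejer_add (by omega) le_rfl, ih (by omega), sum_range_succ,
      sum_range_succ]
    ring

theorem norm_dirichlet_mul_le {A s : ℕ} (hs : s ≤ m A) (x y : VilenkinGroup m) :
    ‖dirichlet (s * bigM m A) x y‖ ≤ m A * ‖dirichlet (bigM m A) x y‖ := by
  rw [dirichlet_mul hs, norm_mul]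
  gcongr
  refine (norm_sum_le _ _).trans ?_
  simpa [norm_rho] using hs

theorem norm_sum_dirichlet_mul_le {A s : ℕ} (hs : s ≤ m A) (x y : VilenkinGroup m) :
    ‖∑ t ∈ range s, dirichlet (t * bigM m A) x y‖ ≤ m A * m A * ‖dirichlet (bigM m A) x y‖ := by
  refine (norm_sum_le _ _).trans ((sum_le_sum fun t ht =>
    norm_dirichlet_mul_le ((mem_range.1 ht).le.trans hs) x y).trans ?_)
  rw [sum_const, card_range, nsmul_eq_mul, mul_assoc]
  gcongr

/-! ### Estimate of the Fejér kernels -/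

/-- The set of points that agree with `x` in the coordinates below `n`, except possibly in the
coordinate `t`. -/
abbrev cross (t n : ℕ) (x : VilenkinGroup m) : Set (VilenkinGroup m) := box ((range n).erase t) x

/-- The weight `M_n ∑_{t ≤ n} M_t 1_{cross t n}`. -/
def weight (n : ℕ) (x y : VilenkinGroup m) : ℝ :=
  bigM m n * ∑ t ∈ range (n + 1), (cross t n x).indicator (fun _ => (bigM m t : ℝ)) y

/-- The sum of the weights up to `n`. -/
def totalWeight (n : ℕ) (x y : VilenkinGroup m) : ℝ := ∑ k ∈ range (n + 1), weight k x y

theorem indicator_bigM_nonneg (s : Set (VilenkinGroup m)) (t : ℕ) (y : VilenkinGroup m) :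
    0 ≤ s.indicator (fun _ => (bigM m t : ℝ)) y :=
  Set.indicator_nonneg (fun _ _ => Nat.cast_nonneg _) _

theorem weight_nonneg (n : ℕ) (x y : VilenkinGroup m) : 0 ≤ weight n x y :=
  mul_nonneg (Nat.cast_nonneg _) (sum_nonneg fun _ _ => indicator_bigM_nonneg _ _ _)

theorem totalWeight_nonneg (n : ℕ) (x y : VilenkinGroup m) : 0 ≤ totalWeight n x y :=
  sum_nonneg fun _ _ => weight_nonneg _ _ _

theorem norm_dirichlet_bigM (A : ℕ) (x y : VilenkinGroup m) :
    ‖dirichlet (bigM m A) x y‖ = (interval m A x).indicator (fun _ => (bigM m A : ℝ)) y := by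
  rw [dirichlet_bigM, Set.indicator, Set.indicator]
  split_ifs <;> simp

theorem mul_indicator_le_weight (A : ℕ) (x y : VilenkinGroup m) :
    bigM m A * (interval m A x).indicator (fun _ => (bigM m A : ℝ)) y ≤ weight A x y := by
  refine mul_le_mul_of_nonneg_left ?_ (Nat.cast_nonneg _)
  have h : interval m A x = cross A A x := by
    rw [interval_eq_box, cross, erase_eq_of_notMem (by simp)]
  rw [h]
  exact single_le_sum (f := fun t => (cross t A x).indicator (fun _ => (bigM m t : ℝ)) y)
    (fun t _ => indicator_bigM_nonneg _ _ _) (mem_range.2 (Nat.lt_succ_self A))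

/-- This mirrors `fejer_mul` with s = m_A. The Dirichlet part lives on I_A(x), which is the cross of
level A + 1 with free coordinate A. The Fejér part survives only where the coordinates A agree, and
there the crosses of level A with t < A are crosses of level A + 1, while the cross with t = A
becomes the one with t = A + 1. -/
theorem weight_step (A : ℕ) (x y : VilenkinGroup m) :
    m A * bigM m A * (interval m A x).indicator (fun _ => (bigM m A : ℝ)) y
      + (if y A = x A then (m A : ℝ) else 0) * weight A x y ≤ weight (A + 1) x y := by
  have hcast : (bigM m (A + 1) : ℝ) = m A * bigM m A := by rw [bigM_succ]; push_cast; ring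
  have hcr : interval m A x = cross A (A + 1) x := by
    rw [interval_eq_box, cross, range_add_one, erase_insert (by simp)]
  unfold weight
  rw [hcast, sum_range_succ _ (A + 1), sum_range_succ, hcr]
  split_ifs with h
  · have h1 (t : ℕ) (ht : t ≠ A) : y ∈ cross t (A + 1) x ↔ y ∈ cross t A x := by
      rw [cross, range_add_one, erase_insert_of_ne ht.symm]
      simp [box, h]
    have h2 : y ∈ cross (A + 1) (A + 1) x ↔ y ∈ cross A A x := by
      rw [cross, cross, erase_eq_of_notMem (by simp), erase_eq_of_notMem (by simp), range_add_one]
      simp [box, h]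
    rw [sum_range_succ _ A]
    have h3 : ∑ t ∈ range A, (cross t A x).indicator (fun _ => (bigM m t : ℝ)) y
        = ∑ t ∈ range A, (cross t (A + 1) x).indicator (fun _ => (bigM m t : ℝ)) y :=
      sum_congr rfl fun t ht => by
        by_cases h6 : y ∈ cross t A x <;> simp [Set.indicator, h1 t (mem_range.1 ht).ne, h6]
    have h4 : (cross A A x).indicator (fun _ => (bigM m A : ℝ)) y
        ≤ (cross (A + 1) (A + 1) x).indicator (fun _ => (bigM m (A + 1) : ℝ)) y := by
      by_cases h5 : y ∈ cross A A x
      · rw [Set.indicator_of_mem h5, Set.indicator_of_mem (h2.2 h5)]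
        exact bigM_cast_mono (Nat.le_succ A)
      · rw [Set.indicator_of_notMem h5]
        exact indicator_bigM_nonneg _ _ _
    rw [h3]
    have h5 : (0:ℝ) ≤ m A * bigM m A := by positivity
    nlinarith [mul_le_mul_of_nonneg_left h4 h5]
  · rw [zero_mul, add_zero]
    refine mul_le_mul_of_nonneg_left ?_ (by positivity)
    have := sum_nonneg (s := range A) fun t _ => indicator_bigM_nonneg (cross t (A + 1) x) t y
    have h2 := indicator_bigM_nonneg (cross (A + 1) (A + 1) x) (A + 1) y
    rw [sum_range_succ]
    linarith

/-- The constant does not grow in the induction, because `weight_step` has coefficient one; B only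
pays for the surplus factor m_A from the sum of m_A Dirichlet kernels. -/
theorem norm_fejer_bigM_le {B : ℕ} (hB : ∀ k, m k ≤ B) (A : ℕ) (x y : VilenkinGroup m) :
    ‖fejer (bigM m A) x y‖ ≤ B * weight A x y := by
  induction A with
  | zero =>
    simp only [fejer, bigM, range_one, sum_singleton, dirichlet, range_zero, sum_empty, norm_zero]
    exact mul_nonneg (Nat.cast_nonneg _) (weight_nonneg _ _ _)
  | succ A ih =>
    have hB' : (m A : ℝ) ≤ B := by exact_mod_cast hB A
    set E := (interval m A x).indicator (fun _ => (bigM m A : ℝ)) y with hE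
    have hE0 : 0 ≤ E := indicator_bigM_nonneg _ _ _
    have h1 := norm_sum_dirichlet_mul_le (A := A) le_rfl x y
    rw [norm_dirichlet_bigM, ← hE] at h1
    have h2 : ‖∑ t ∈ range (m A), rho A x y ^ t‖ = if y A = x A then (m A : ℝ) else 0 := by
      rw [sum_rho_pow]; split_ifs <;> simp
    rw [bigM_succ, fejer_mul le_rfl]
    calc _ ≤ bigM m A * (m A * m A * E)
          + (if y A = x A then (m A : ℝ) else 0) * (B * weight A x y) := by
          refine (norm_add_le _ _).trans ?_
          rw [norm_mul, norm_mul, h2, Complex.norm_natCast]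
          gcongr
      _ ≤ B * (m A * bigM m A * E + (if y A = x A then (m A : ℝ) else 0) * weight A x y) := by
          have : m A * (m A * bigM m A * E) ≤ B * (m A * bigM m A * E) := by gcongr
          linarith
      _ ≤ _ := by gcongr; exact weight_step A x y

/-- The leading digit of n is split off repeatedly. Each digit costs 2 B^2 weights for the block
`fejer (s * bigM m K)` and B^2 weights for the l copies of the Dirichlet block. -/
theorem norm_fejer_le {B : ℕ} (hB : ∀ k, m k ≤ B) {K n : ℕ} (hn : n < bigM m K)
    (x y : VilenkinGroup m) :
    ‖fejer n x y‖ ≤ 3 * B ^ 2 * ∑ A ∈ range K, weight A x y := by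
  induction K generalizing n with
  | zero =>
    have : n = 0 := by simpa [bigM] using hn
    simp [this, fejer]
  | succ K ih =>
    have hB1 : (1 : ℝ) ≤ B := by exact_mod_cast le_trans (Nat.pos_of_neZero (m 0)) (hB 0)
    have hB' : (m K : ℝ) ≤ B := by exact_mod_cast hB K
    have hs : n / bigM m K < m K := (Nat.div_lt_iff_lt_mul (bigM_pos K)).2 hn
    have hl := Nat.mod_lt n (bigM_pos (m := m) K)
    set s := n / bigM m K
    set l := n % bigM m K
    have hnsl : n = s * bigM m K + l := (Nat.div_add_mod' n _).symm
    have hW := weight_nonneg K x y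
    set D := ‖dirichlet (bigM m K) x y‖ with hD
    have hMD : bigM m K * D ≤ weight K x y := by
      rw [hD, norm_dirichlet_bigM]; exact mul_indicator_le_weight K x y
    have h1 : ‖fejer (s * bigM m K) x y‖ ≤ 2 * B ^ 2 * weight K x y := by
      rw [fejer_mul hs.le]
      have h2 := norm_sum_dirichlet_mul_le hs.le x y
      have h3 : ‖∑ t ∈ range s, rho K x y ^ t‖ ≤ B := by
        refine (norm_sum_le _ _).trans ?_
        simp only [norm_pow, norm_rho, one_pow, sum_const, card_range, nsmul_eq_mul, mul_one]
        exact le_trans (by exact_mod_cast hs.le) hB'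
      calc _ ≤ bigM m K * (m K * m K * D) + B * (B * weight K x y) := by
            refine (norm_add_le _ _).trans ?_
            rw [norm_mul, norm_mul, Complex.norm_natCast]
            gcongr
            exact norm_fejer_bigM_le hB K x y
        _ = m K * m K * (bigM m K * D) + B * (B * weight K x y) := by ring
        _ ≤ B * B * weight K x y + B * (B * weight K x y) := by gcongr
        _ = _ := by ring
    have h4 : ‖(l : ℂ) * dirichlet (s * bigM m K) x y‖ ≤ B ^ 2 * weight K x y := by
      rw [norm_mul, Complex.norm_natCast]
      have hl' : (l : ℝ) ≤ bigM m K := by exact_mod_cast hl.le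
      calc (l : ℝ) * ‖dirichlet (s * bigM m K) x y‖ ≤ bigM m K * (m K * D) := by
            gcongr
            exact norm_dirichlet_mul_le hs.le x y
        _ = m K * (bigM m K * D) := by ring
        _ ≤ B * weight K x y := by gcongr
        _ ≤ B ^ 2 * weight K x y := by gcongr; exact le_self_pow₀ hB1 two_ne_zero
    have h5 := ih hl
    rw [hnsl, fejer_add hs hl.le, sum_range_succ, mul_add]
    refine (norm_add₃_le).trans ?_
    rw [norm_mul (rho K x y ^ s), norm_pow, norm_rho, one_pow, one_mul]
    linarith
/-! ### Fejér means of atoms -/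

theorem atLevel_weight (n : ℕ) (x : VilenkinGroup m) : AtLevel n (weight n x) := by
  intro y y' hy
  unfold weight
  congr 1
  refine sum_congr rfl fun t _ => ?_
  have h := atLevel_mem_box (s := (range n).erase t) (erase_subset _ _) x y y' hy
  have h' : y' ∈ cross t n x ↔ y ∈ cross t n x := iff_of_eq h
  by_cases h1 : y ∈ cross t n x
  · rw [Set.indicator_of_mem h1, Set.indicator_of_mem (h'.2 h1)]
  · rw [Set.indicator_of_notMem h1, Set.indicator_of_notMem (fun h2 => h1 (h'.1 h2))]

theorem setIntegral_weight (k n : ℕ) (z x : VilenkinGroup m) :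
    ∫ y in interval m k z, weight n x y ∂(haar m)
      = bigM m n * ∑ t ∈ range (n + 1),
        bigM m t * (haar m).real (interval m k z ∩ cross t n x) := by
  unfold weight
  rw [integral_const_mul, integral_finsetSum]
  · congr 1
    refine sum_congr rfl fun t _ => ?_
    rw [setIntegral_indicator (measurableSet_box _ _), setIntegral_const, smul_eq_mul, mul_comm]
  · exact fun t _ => ((integrable_const _).indicator (measurableSet_box _ _))

/-- The integral of a weight over an interval. -/
theorem setIntegral_weight_le {B : ℕ} (hB : ∀ k, m k ≤ B) (k n : ℕ) (z x : VilenkinGroup m) :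
    ∫ y in interval m k z, weight n x y ∂(haar m) ≤ 2 * B * bigM m n := by
  rw [setIntegral_weight]
  have hM := bigM_cast_pos (m := m) n
  calc _ ≤ bigM m n * ∑ t ∈ range (n + 1), bigM m t * (B * (bigM m n : ℝ)⁻¹) := by
        gcongr with t
        exact (measureReal_mono Set.inter_subset_right).trans (haar_box_erase_le hB t n x)
    _ = B * ∑ t ∈ range (n + 1), (bigM m t : ℝ) := by
        rw [← sum_mul]; field_simp
    _ ≤ B * (2 * bigM m n) := by gcongr; exact sum_bigM_le n
    _ = _ := by ring

/-- The integral of a weight over an interval that does not contain the point `x`. -/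
theorem setIntegral_weight_le_of_notMem (k n : ℕ) {z x : VilenkinGroup m}
    (hx : x ∉ interval m k z) :
    ∫ y in interval m k z, weight n x y ∂(haar m)
      ≤ (bigM m k : ℝ)⁻¹ * if n ≤ k then weight n z x else weight k z x := by
  rw [setIntegral_weight]
  have hM := bigM_cast_pos (m := m) n
  -- For n ≤ k the coordinates that define the cross are constant on I_k(z), so the cross around x
  -- meets I_k(z) only if x lies in the same cross around z.
  split_ifs with hnk
  · unfold weight
    rw [mul_left_comm, mul_sum (range (n + 1)) _ (bigM m k : ℝ)⁻¹]
    refine mul_le_mul_of_nonneg_left (sum_le_sum fun t _ => ?_) hM.le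
    by_cases h : x ∈ cross t n z
    · rw [Set.indicator_of_mem h, mul_comm]
      gcongr
      rw [← haar_interval k z]
      exact measureReal_mono Set.inter_subset_left
    · have hempty : interval m k z ∩ cross t n x = ∅ := by
        refine Set.eq_empty_of_forall_notMem fun y hy => h fun j hj => ?_
        rw [← hy.2 j hj, hy.1 j ((mem_range.1 (mem_of_mem_erase hj)).trans_le hnk)]
      rw [hempty, Set.indicator_of_notMem h]; simp
  · have hkn : k < n := not_le.1 hnk
    have hk := bigM_cast_pos (m := m) k
    rw [weight, ← mul_assoc, inv_mul_cancel₀ hk.ne', one_mul]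
    have hsub : range (k + 1) ⊆ range (n + 1) := range_subset_range.2 (by omega)
    have hterm (t : ℕ) : bigM m n * (bigM m t * (haar m).real (interval m k z ∩ cross t n x))
        ≤ if t ∈ range (k + 1) then (cross t k z).indicator (fun _ => (bigM m t : ℝ)) x else 0 := by
      have hemp (h : interval m k z ∩ cross t n x = ∅) :
          bigM m n * (bigM m t * (haar m).real (interval m k z ∩ cross t n x))
          ≤ if t ∈ range (k + 1) then (cross t k z).indicator (fun _ => (bigM m t : ℝ)) x
            else 0 := by
        rw [h, measureReal_empty, mul_zero, mul_zero]
        split_ifs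
        exacts [indicator_bigM_nonneg _ _ _, le_rfl]
      rcases Set.eq_empty_or_nonempty (interval m k z ∩ cross t n x) with h | ⟨y₀, hy₀, hy₀'⟩
      · exact hemp h
      -- For t < k the coordinate t is fixed by I_k(z) and all others below n by x, so the
      -- intersection lies in one interval of level n, whose measure cancels M_n. For t ≥ k a common
      -- point would force x into I_k(z).
      by_cases htk : t < k
      · have hxc : x ∈ cross t k z := fun j hj => by
          have hj' := mem_range.1 (mem_of_mem_erase hj)
          rw [← hy₀ j hj', hy₀' j (mem_erase.2
            ⟨ne_of_mem_erase hj, mem_range.2 (hj'.trans hkn)⟩)]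
        rw [if_pos (mem_range.2 (by omega)), Set.indicator_of_mem hxc]
        have hle : (haar m).real (interval m k z ∩ cross t n x) ≤ (bigM m n : ℝ)⁻¹ := by
          rw [← haar_interval n y₀]
          refine measureReal_mono fun y hy j hj => ?_
          by_cases hjt : j = t
          · subst hjt
            rw [hy.1 j htk, hy₀ j htk]
          · have hj' := mem_erase.2 ⟨hjt, mem_range.2 hj⟩
            rw [hy.2 j hj', hy₀' j hj']
        calc _ ≤ bigM m n * (bigM m t * (bigM m n : ℝ)⁻¹) := by gcongr
          _ = _ := by field_simp
      · refine absurd (fun j hj => ?_) hx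
        rw [← hy₀ j hj, hy₀' j (mem_erase.2 ⟨by omega, mem_range.2 (hj.trans hkn)⟩)]
    rw [mul_sum]
    refine (sum_le_sum fun t _ => hterm t).trans ?_
    rw [sum_ite_mem, inter_eq_right.2 hsub]

theorem weight_le_totalWeight (k : ℕ) (x y : VilenkinGroup m) : weight k x y ≤ totalWeight k x y :=
  single_le_sum (f := fun k => weight k x y) (fun _ _ => weight_nonneg _ _ _)
    (mem_range.2 (Nat.lt_succ_self k))

theorem integral_mul_fejer_le_aux {B : ℕ} (hB : ∀ k, m k ≤ B) {a n k : ℕ}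
    (hn : n < bigM m (a + 1)) {β : ℝ} {z : VilenkinGroup m} {b : VilenkinGroup m → ℂ}
    (hβ : ∀ y, ‖b y‖ ≤ β) (hsupp : ∀ y ∉ interval m k z, b y = 0) (x : VilenkinGroup m) :
    ‖∫ y, b y * fejer n x y ∂(haar m)‖
      ≤ β * (3 * B ^ 2 * ∑ A ∈ range (a + 1), ∫ y in interval m k z, weight A x y ∂(haar m)) := by
  have hβ0 : 0 ≤ β := (norm_nonneg _).trans (hβ z)
  have hint (A : ℕ) : IntegrableOn (weight A x) (interval m k z) (haar m) :=
    (atLevel_weight A x).integrable_real.integrableOn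
  rw [← integral_finsetSum _ fun A _ => hint A, ← integral_const_mul, ← integral_const_mul,
    ← setIntegral_eq_integral_of_forall_compl_eq_zero (s := interval m k z)
      fun y hy => by rw [hsupp y hy, zero_mul]]
  refine norm_integral_le_of_norm_le ?_ (ae_of_all _ fun y => ?_)
  · exact ((integrable_finsetSum _ fun A _ => hint A).const_mul _).const_mul _
  · rw [norm_mul]
    exact mul_le_mul (hβ y) (norm_fejer_le hB hn x y) (norm_nonneg _) hβ0

/-- Pointwise estimate of the Fejér means of an atom. -/
theorem norm_integral_mul_fejer_le {B : ℕ} (hB : ∀ k, m k ≤ B) {n k : ℕ} (hn : 1 ≤ n)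
    {β : ℝ} {z : VilenkinGroup m} {b : VilenkinGroup m → ℂ}
    (hβ : ∀ y, ‖b y‖ ≤ β) (hsupp : ∀ y ∉ interval m k z, b y = 0)
    (hmean : k = 0 ∨ ∫ y, b y ∂(haar m) = 0) (x : VilenkinGroup m) :
    ‖∫ y, b y * fejer n x y ∂(haar m)‖
      ≤ n * (12 * B ^ 3 * β * ((bigM m k : ℝ)⁻¹ ^ 2 * totalWeight k z x)) := by
  have hβ0 : 0 ≤ β := (norm_nonneg _).trans (hβ z)
  have hB1 : (1 : ℝ) ≤ B := by exact_mod_cast le_trans (Nat.pos_of_neZero (m 0)) (hB 0)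
  have hk := bigM_cast_pos (m := m) k
  have hV := totalWeight_nonneg k z x
  obtain ⟨a, ha, ha'⟩ := exists_bigM_le (m := m) hn
  have han : (bigM m a : ℝ) ≤ n := by exact_mod_cast ha
  -- On I_k(z) itself no cancellation is needed, since `totalWeight k z x` is at least M_k^2 there.
  -- For k = 0 this is the only case, which is why no mean value condition is imposed then.
  by_cases hx : x ∈ interval m k z
  · refine (integral_mul_fejer_le_aux hB ha' hβ hsupp x).trans ?_
    have h1 : ∑ A ∈ range (a + 1), ∫ y in interval m k z, weight A x y ∂(haar m)
        ≤ 4 * B * n := by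
      refine (sum_le_sum fun A _ => setIntegral_weight_le hB k A z x).trans ?_
      rw [← mul_sum]
      have := sum_bigM_le (m := m) a
      nlinarith
    have h2 : 1 ≤ (bigM m k : ℝ)⁻¹ ^ 2 * totalWeight k z x := by
      have := (mul_indicator_le_weight k z x).trans (weight_le_totalWeight k z x)
      rw [Set.indicator_of_mem hx] at this
      rw [inv_pow, ← div_eq_inv_mul, one_le_div (by positivity)]
      linarith
    calc _ ≤ β * (3 * B ^ 2 * (4 * B * n)) := by gcongr
      _ = n * (12 * B ^ 3 * β * 1) := by ring
      _ ≤ _ := by gcongr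
  · have hk0 : k ≠ 0 := by
      rintro rfl
      exact hx fun j hj => absurd hj (by omega)
    -- For n ≤ M_k the kernel is constant in y on I_k(z), and the mean value zero gives 0.
    rcases le_or_gt n (bigM m k) with hnk | hnk
    · have h0 : ∫ y, b y * fejer n x y ∂(haar m) = 0 := by
        have : (fun y => b y * fejer n x y) = fun y => b y * fejer n x z := by
          ext y
          by_cases hy : y ∈ interval m k z
          · rw [atLevel_fejer hnk x z y hy]
          · rw [hsupp y hy, zero_mul, zero_mul]
        rw [this, integral_mul_const, hmean.resolve_left hk0, zero_mul]
      rw [h0, norm_zero]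
      positivity
    · have hka : k ≤ a := by
        by_contra h
        exact absurd (ha'.trans_le (bigM_mono (m := m) (show a + 1 ≤ k by omega))) (by omega)
      -- The levels up to k give one total weight, and each of the d levels above k at most one
      -- more. Since d ≤ 2^d ≤ n / M_k, the count 1 + d is at most 2 n / M_k.
      obtain ⟨d, rfl⟩ := Nat.exists_eq_add_of_le hka
      refine (integral_mul_fejer_le_aux hB ha' hβ hsupp x).trans ?_
      have hd : (d : ℝ) * bigM m k ≤ n := by
        have h1 : d * bigM m k ≤ 2 ^ d * bigM m k :=
          Nat.mul_le_mul_right _ Nat.lt_two_pow_self.le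
        exact_mod_cast (h1.trans (two_pow_mul_bigM_le k d)).trans ha
      have hnk' : (bigM m k : ℝ) ≤ n := by exact_mod_cast hnk.le
      have h1 : ∑ A ∈ range (k + d + 1), ∫ y in interval m k z, weight A x y ∂(haar m)
          ≤ (bigM m k : ℝ)⁻¹ * (totalWeight k z x + d * totalWeight k z x) := by
        refine (sum_le_sum fun A _ => setIntegral_weight_le_of_notMem k A hx).trans ?_
        rw [← mul_sum, show k + d + 1 = (k + 1) + d by ring, sum_range_add]
        gcongr
        · refine sum_le_sum fun A hA => ?_
          rw [if_pos (Nat.lt_succ_iff.1 (mem_range.1 hA))]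
        · refine (sum_le_card_nsmul _ _ (totalWeight k z x) fun A _ => ?_).trans ?_
          · rw [if_neg (by omega)]
            exact weight_le_totalWeight k z x
          · simp
      have h2 : 1 + (d : ℝ) ≤ 2 * (n * (bigM m k : ℝ)⁻¹) := by
        rw [← div_eq_mul_inv, mul_div_assoc', le_div_iff₀ hk]
        linarith
      calc _ ≤ β * (3 * B ^ 2 * ((bigM m k : ℝ)⁻¹ * ((1 + d) * totalWeight k z x))) := by
            rw [add_mul, one_mul]; gcongr
        _ ≤ β * (3 * B ^ 2 * ((bigM m k : ℝ)⁻¹ * (2 * (n * (bigM m k : ℝ)⁻¹)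
              * totalWeight k z x))) := by gcongr
        _ = n * (6 * B ^ 2 * β * ((bigM m k : ℝ)⁻¹ ^ 2 * totalWeight k z x)) := by ring
        _ ≤ _ := by
          gcongr
          · norm_num
          · norm_num

/-! ### A weak type estimate for the weights -/

/-- Since x and z differ in the coordinate s, for A > s only the cross with t = s can contain x, and
for A ≥ u not even that one. So weight A is at most 2 M_s M_A for A < u (for A ≤ s by the trivial
bound) and vanishes afterwards; the geometric sum is governed by M_{u-1} M_s. -/
theorem totalWeight_le {ρ : ℝ} {s u k : ℕ} {z x : VilenkinGroup m} (hs : x s ≠ z s)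
    (hsu : s < u) (hx : x ∉ cross s u z) (hρ : ∀ A, s ≤ A → A < u → bigM m A * bigM m s ≤ ρ)
    (hmin : ∀ A, A ≤ s → bigM m A ≤ bigM m s) : totalWeight k z x ≤ 4 * ρ := by
  have hw (A : ℕ) : weight A z x ≤ if A ∈ range u then 2 * bigM m s * (bigM m A : ℝ) else 0 := by
    have hMA := bigM_cast_pos (m := m) A
    have hle : ∑ t ∈ range (A + 1), (cross t A z).indicator (fun _ => (bigM m t : ℝ)) x
        ≤ if A ∈ range u then 2 * (bigM m s : ℝ) else 0 := by
      by_cases hAs : A ≤ s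
      · rw [if_pos (mem_range.2 (by omega))]
        calc ∑ t ∈ range (A + 1), (cross t A z).indicator (fun _ => (bigM m t : ℝ)) x
            ≤ ∑ t ∈ range (A + 1), (bigM m t : ℝ) :=
              sum_le_sum fun t _ =>
                Set.indicator_le_self' (f := fun _ => (bigM m t : ℝ)) (fun _ _ => Nat.cast_nonneg _) x
          _ ≤ 2 * bigM m A := sum_bigM_le A
          _ ≤ 2 * bigM m s := by gcongr; exact hmin A hAs
      · have hzero (t : ℕ) (hts : t ≠ s) :
            (cross t A z).indicator (fun _ => (bigM m t : ℝ)) x = 0 := by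
          refine Set.indicator_of_notMem (fun h : x ∈ cross t A z => hs (h s ?_)) _
          exact mem_erase.2 ⟨hts.symm, mem_range.2 (by omega)⟩
        rw [sum_eq_single s (fun t _ hts => hzero t hts)
          fun h => absurd (mem_range.2 (show s < A + 1 by omega)) h]
        split_ifs with hAu
        · refine (Set.indicator_le_self' (fun _ _ => Nat.cast_nonneg _) _).trans ?_
          have := bigM_cast_pos (m := m) s
          linarith
        · rw [Set.indicator_of_notMem fun h => hx (box_subset (erase_subset_erase _
            (range_subset_range.2 (by simpa using hAu))) z h)]
    unfold weight
    refine (mul_le_mul_of_nonneg_left hle hMA.le).trans ?_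
    split_ifs
    · exact le_of_eq (by ring)
    · simp
  obtain ⟨v, rfl⟩ : ∃ v, u = v + 1 := ⟨u - 1, by omega⟩
  calc totalWeight k z x
      ≤ ∑ A ∈ range (k + 1), if A ∈ range (v + 1) then 2 * bigM m s * (bigM m A : ℝ) else 0 :=
        sum_le_sum fun A _ => hw A
    _ = ∑ A ∈ range (k + 1) ∩ range (v + 1), 2 * bigM m s * (bigM m A : ℝ) := by
        rw [sum_ite_mem]
    _ ≤ ∑ A ∈ range (v + 1), 2 * bigM m s * (bigM m A : ℝ) :=
        sum_le_sum_of_subset_of_nonneg inter_subset_right fun _ _ _ => by positivity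
    _ = 2 * bigM m s * ∑ A ∈ range (v + 1), (bigM m A : ℝ) := by rw [mul_sum]
    _ ≤ 2 * bigM m s * (2 * bigM m v) := by gcongr; exact sum_bigM_le v
    _ = 4 * (bigM m v * bigM m s) := by ring
    _ ≤ 4 * ρ := by gcongr; exact hρ v (by omega) (by omega)

/-- The first such u balances two demands: M_A M_t stays below ρ for t < A < u, and cross t u has
measure at most B / M_u ≤ B M_t / ρ. -/
theorem exists_bigM_mul_ge (ρ : ℝ) (t : ℕ) :
    ∃ u, t < u ∧ ρ ≤ bigM m u * bigM m t ∧ ∀ A, t < A → A < u → bigM m A * bigM m t < ρ := by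
  classical
  have hex : ∃ u, t < u ∧ ρ ≤ bigM m u * bigM m t := by
    obtain ⟨n, hn⟩ := exists_nat_ge ρ
    refine ⟨max n (t + 1), by simp, hn.trans ?_⟩
    have h1 : (n : ℝ) ≤ bigM m (max n (t + 1)) := by
      exact_mod_cast (le_max_left n (t + 1)).trans (lt_bigM _).le
    nlinarith [one_le_bigM (m := m) t, one_le_bigM (m := m) (max n (t + 1))]
  refine ⟨Nat.find hex, (Nat.find_spec hex).1, (Nat.find_spec hex).2, fun A hA hA' => ?_⟩
  have := Nat.find_min hex hA'
  push Not at this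
  exact this hA

/-- With s₀ minimal such that M_{s₀} ≥ √ρ, the set is covered by I_{s₀}(z) and the crosses `cross t
(u t) z`, t < s₀: any other x differs from z in some coordinate s < s₀, and `totalWeight_le`
applies. The measures are at most 1/√ρ and B M_t / ρ, and ∑_{t<s₀} M_t ≤ 2√ρ. -/
theorem measure_totalWeight_le {B : ℕ} (hB : ∀ k, m k ≤ B) (k : ℕ) (z : VilenkinGroup m) {ρ : ℝ}
    (hρ : 0 < ρ) :
    (haar m).real {x | 4 * ρ < totalWeight k z x} * √ρ ≤ 1 + 2 * B := by
  classical
  have hex : ∃ s, √ρ ≤ bigM m s := by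
    obtain ⟨n, hn⟩ := exists_nat_ge √ρ
    exact ⟨n, hn.trans (by exact_mod_cast (lt_bigM n).le)⟩
  set s₀ := Nat.find hex
  have hs₀ : √ρ ≤ bigM m s₀ := Nat.find_spec hex
  have hlt (t : ℕ) (ht : t < s₀) : (bigM m t : ℝ) < √ρ := not_le.1 (Nat.find_min hex ht)
  choose u hu1 hu2 hu3 using exists_bigM_mul_ge (m := m) ρ
  have hr : 0 < √ρ := Real.sqrt_pos.2 hρ
  have hsq : √ρ * √ρ = ρ := Real.mul_self_sqrt hρ.le
  have hsub : {x | 4 * ρ < totalWeight k z x}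
      ⊆ interval m s₀ z ∪ ⋃ t ∈ range s₀, cross t (u t) z := by
    intro x hx
    by_contra hcon
    simp only [Set.mem_union, Set.mem_iUnion, not_or, not_exists] at hcon
    obtain ⟨h1, h2⟩ := hcon
    have hdiff : ∃ s, x s ≠ z s ∧ s < s₀ := by
      by_contra h
      push Not at h
      exact h1 fun j hj => by
        by_contra hne
        exact absurd hj (not_lt.2 (h j hne))
    obtain ⟨s, hs, hss⟩ := hdiff
    refine absurd hx (not_lt.2 (totalWeight_le hs (hu1 s) (h2 s (mem_range.2 hss)) ?_
      fun A hA => bigM_mono hA))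
    intro A hA hA'
    -- The case A = s is not covered by the choice of u; it holds because M_s < √ρ.
    rcases hA.eq_or_lt with rfl | h
    · have := hlt s hss
      have := bigM_cast_pos (m := m) s
      nlinarith
    · exact (hu3 s A h hA').le
  have hterm (t : ℕ) : (haar m).real (cross t (u t) z) * √ρ ≤ B * (bigM m t / √ρ) := by
    have hu := bigM_cast_pos (m := m) (u t)
    calc _ ≤ B * (bigM m (u t) : ℝ)⁻¹ * √ρ := by
          gcongr
          exact haar_box_erase_le hB t (u t) z
      _ ≤ _ := by
        rw [mul_assoc]
        gcongr
        rw [inv_mul_eq_div, div_le_div_iff₀ hu hr, hsq, mul_comm]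
        exact hu2 t
  have hsum : ∑ t ∈ range s₀, (bigM m t : ℝ) ≤ 2 * √ρ := by
    rcases Nat.eq_zero_or_eq_succ_pred s₀ with h | h
    · rw [h]; simp
    · rw [h]
      refine (sum_bigM_le _).trans ?_
      have := hlt (s₀.pred) (by omega)
      linarith
  calc _ ≤ ((haar m).real (interval m s₀ z) + ∑ t ∈ range s₀, (haar m).real (cross t (u t) z))
        * √ρ := by
        gcongr
        refine (measureReal_mono hsub).trans ((measureReal_union_le _ _).trans ?_)
        gcongr
        exact measureReal_biUnion_finset_le _ _
    _ = (haar m).real (interval m s₀ z) * √ρ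
        + ∑ t ∈ range s₀, (haar m).real (cross t (u t) z) * √ρ := by rw [add_mul, sum_mul]
    _ ≤ 1 + ∑ t ∈ range s₀, B * (bigM m t / √ρ) := by
        refine add_le_add ?_ (sum_le_sum fun t _ => hterm t)
        rw [haar_interval, inv_mul_eq_div]
        exact div_le_one_of_le₀ hs₀ (Nat.cast_nonneg _)
    _ = 1 + B * ((∑ t ∈ range s₀, (bigM m t : ℝ)) / √ρ) := by rw [← mul_sum, sum_div]
    _ ≤ 1 + B * 2 := by gcongr; rwa [div_le_iff₀ hr]
    _ = _ := by ring

end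

end Vilenkin

/-! ### Sums of functions of weak type `1/2` -/

section WeakSum

variable {Ω : Type*} [MeasurableSpace Ω] {μ : Measure Ω} [IsProbabilityMeasure μ]

theorem integrable_min_const {F : Ω → ℝ} (hF : Measurable F) (h0 : ∀ x, 0 ≤ F x) {t : ℝ}
    (ht : 0 < t) : Integrable (fun x => min (F x) t) μ :=
  Integrable.of_bound (hF.min measurable_const).aestronglyMeasurable t
    (ae_of_all _ fun x => by
      rw [Real.norm_of_nonneg (le_min (h0 x) ht.le)]; exact min_le_right _ _)

/-- Layer cake: truncation at t limits the range to (0, t), where a r^{-1/2} is integrable with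
integral 2 a √t. -/
theorem integral_min_le_of_weak {F : Ω → ℝ} (hF : Measurable F) (h0 : ∀ x, 0 ≤ F x) {a : ℝ}
    (hw : ∀ r, 0 < r → μ.real {x | r < F x} * √r ≤ a) {t : ℝ} (ht : 0 < t) :
    ∫ x, min (F x) t ∂μ ≤ 2 * a * √t := by
  rw [(integrable_min_const hF h0 ht).integral_eq_integral_meas_lt
    (ae_of_all _ fun x => le_min (h0 x) ht.le)]
  have hi : IntervalIntegrable (fun r : ℝ => a * r ^ (-(1 / 2) : ℝ)) volume 0 t :=
    (intervalIntegral.intervalIntegrable_rpow' (by norm_num)).const_mul a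
  have hval : ∫ r in (0 : ℝ)..t, a * r ^ (-(1 / 2) : ℝ) = 2 * a * √t := by
    rw [intervalIntegral.integral_const_mul, integral_rpow (Or.inl (by norm_num)),
      Real.sqrt_eq_rpow, Real.zero_rpow (by norm_num)]
    norm_num
    ring
  rw [← hval, intervalIntegral.integral_of_le ht.le,
    ← integral_indicator measurableSet_Ioc, ← integral_indicator measurableSet_Ioi]
  refine integral_mono_of_nonneg (ae_of_all _ fun r => ?_) ?_ (ae_of_all _ fun r => ?_)
  · exact Set.indicator_nonneg (fun _ _ => measureReal_nonneg) _
  · exact ((intervalIntegrable_iff_integrableOn_Ioc_of_le ht.le).1 hi).integrable_indicator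
      measurableSet_Ioc
  · by_cases hr : 0 < r
    · rw [Set.indicator_of_mem (Set.mem_Ioi.2 hr)]
      by_cases hrt : r ≤ t
      · rw [Set.indicator_of_mem (Set.mem_Ioc.2 ⟨hr, hrt⟩), Real.rpow_neg hr.le,
          ← Real.sqrt_eq_rpow, ← div_eq_mul_inv, le_div_iff₀ (Real.sqrt_pos.2 hr)]
        refine le_trans ?_ (hw r hr)
        refine mul_le_mul_of_nonneg_right (measureReal_mono fun x hx => ?_) (Real.sqrt_nonneg r)
        exact (lt_min_iff.1 (show r < min (F x) t from hx)).1
      · rw [Set.indicator_of_notMem fun h => hrt h.2]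
        have : {x | r < min (F x) t} = ∅ :=
          Set.eq_empty_of_forall_notMem fun x hx => hrt (lt_min_iff.1 (show r < min (F x) t from hx)).2.le
        rw [this, measureReal_empty]
    · rw [Set.indicator_of_notMem (by simpa using hr),
        Set.indicator_of_notMem fun h => hr h.1]

/-- Either some F_i exceeds t, which the union bound controls at cost ∑ a_i, or the sum equals the
sum of the truncations at t, which Markov's inequality and `integral_min_le_of_weak` control at cost
2 ∑ a_i. Integrability of r^{-1/2} at 0 is what makes weak-L_{1/2} summable in this sense. -/
theorem measure_sum_gt_le {ι : Type*} {s : Finset ι} {F : ι → Ω → ℝ} {a : ι → ℝ}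
    (hF : ∀ i ∈ s, Measurable (F i)) (h0 : ∀ i ∈ s, ∀ x, 0 ≤ F i x)
    (hw : ∀ i ∈ s, ∀ r, 0 < r → μ.real {x | r < F i x} * √r ≤ a i) {t : ℝ} (ht : 0 < t) :
    μ.real {x | t < ∑ i ∈ s, F i x} * √t ≤ 3 * ∑ i ∈ s, a i := by
  have hst := Real.sqrt_pos.2 ht
  have hsub : {x | t < ∑ i ∈ s, F i x}
      ⊆ (⋃ i ∈ s, {x | t < F i x}) ∪ {x | t ≤ ∑ i ∈ s, min (F i x) t} := by
    intro x hx
    by_cases h : ∃ i ∈ s, t < F i x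
    · exact Or.inl (by simpa using h)
    · push Not at h
      refine Or.inr ?_
      have : ∑ i ∈ s, min (F i x) t = ∑ i ∈ s, F i x :=
        sum_congr rfl fun i hi => min_eq_left (h i hi)
      simp only [Set.mem_ofPred_eq, this]
      exact le_of_lt hx
  have h1 : μ.real (⋃ i ∈ s, {x | t < F i x}) * √t ≤ ∑ i ∈ s, a i := by
    calc _ ≤ (∑ i ∈ s, μ.real {x | t < F i x}) * √t := by
          gcongr; exact measureReal_biUnion_finset_le _ _
      _ = ∑ i ∈ s, μ.real {x | t < F i x} * √t := sum_mul _ _ _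
      _ ≤ _ := sum_le_sum fun i hi => hw i hi t ht
  have h2 : μ.real {x | t ≤ ∑ i ∈ s, min (F i x) t} * √t ≤ 2 * ∑ i ∈ s, a i := by
    have hint (i : ι) (hi : i ∈ s) : Integrable (fun x => min (F i x) t) μ :=
      integrable_min_const (hF i hi) (h0 i hi) ht
    have hmk := mul_meas_ge_le_integral_of_nonneg (μ := μ)
      (f := fun x => ∑ i ∈ s, min (F i x) t)
      (ae_of_all _ fun x => sum_nonneg fun i hi => le_min (h0 i hi x) ht.le)
      (integrable_finsetSum _ hint) t
    rw [integral_finsetSum _ hint] at hmk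
    have hle : ∑ i ∈ s, ∫ x, min (F i x) t ∂μ ≤ ∑ i ∈ s, 2 * a i * √t :=
      sum_le_sum fun i hi => integral_min_le_of_weak (hF i hi) (h0 i hi) (hw i hi) ht
    rw [← sum_mul, ← mul_sum] at hle
    have h3 := hmk.trans hle
    refine le_of_mul_le_mul_right ?_ hst
    calc _ = t * μ.real {x | t ≤ ∑ i ∈ s, min (F i x) t} := by
          rw [mul_assoc, Real.mul_self_sqrt ht.le, mul_comm]
      _ ≤ _ := h3
  calc _ ≤ (μ.real (⋃ i ∈ s, {x | t < F i x}) + μ.real {x | t ≤ ∑ i ∈ s, min (F i x) t}) * √t := by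
        gcongr
        exact (measureReal_mono hsub).trans (measureReal_union_le _ _)
    _ ≤ _ := by rw [add_mul]; linarith

end WeakSum

namespace Vilenkin

noncomputable section

set_option linter.unusedSectionVars false

variable {m : ℕ → ℕ} [hm : Fact (∀ k, 2 ≤ m k)]

/-! ### Martingales and their partial sums -/

theorem atLevel_of_martingale {f : ℕ → VilenkinGroup m → ℂ}
    (hf : Martingale f (filtration m) (haar m)) (n : ℕ) : AtLevel n (f n) :=
  atLevel_of_measurable (hf.stronglyMeasurable n).measurable

theorem integral_martingale_diff_mul {f : ℕ → VilenkinGroup m → ℂ}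
    (hf : Martingale f (filtration m) (haar m)) {n : ℕ} {h : VilenkinGroup m → ℂ}
    (hh : AtLevel n h) : ∫ x, (f (n + 1) x - f n x) * h x ∂(haar m) = 0 := by
  refine integral_mul_eq_zero ((hf.integrable _).sub (hf.integrable _)) (fun z => ?_) hh
  have hz : MeasurableSet[filtration m n] (interval m n z) :=
    MeasurableSpace.measurableSet_generateFrom ⟨z, rfl⟩
  rw [integral_sub (hf.integrable _).integrableOn (hf.integrable _).integrableOn,
    hf.setIntegral_eq (Nat.le_succ n) hz, sub_self]

theorem integral_martingale_mul {f : ℕ → VilenkinGroup m → ℂ}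
    (hf : Martingale f (filtration m) (haar m)) {n k : ℕ} (hnk : n ≤ k)
    {h : VilenkinGroup m → ℂ} (hh : AtLevel n h) :
    ∫ x, f k x * h x ∂(haar m) = ∫ x, f n x * h x ∂(haar m) := by
  have hint {i : ℕ} (hi : n ≤ i) : Integrable (fun x => f i x * h x) (haar m) :=
    ((atLevel_of_martingale hf i).comp₂ (hh.mono hi) (· * ·)).integrable
  induction k, hnk using Nat.le_induction with
  | base => rfl
  | succ k hk ih =>
    rw [← ih, ← sub_eq_zero, ← integral_sub (hint (hk.trans (Nat.le_succ k))) (hint hk)]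
    simp_rw [← sub_mul]
    exact integral_martingale_diff_mul hf (hh.mono hk)

theorem coeff_eq {f : ℕ → VilenkinGroup m → ℂ} (hf : Martingale f (filtration m) (haar m))
    {N i : ℕ} (hi : i < bigM m N) :
    coeff m f i = ∫ x, f N x * conj (psi m i x) ∂(haar m) := by
  refine Tendsto.limUnder_eq (tendsto_const_nhds.congr' ?_)
  filter_upwards [eventually_ge_atTop N] with k hk
  exact (integral_martingale_mul hf hk ((atLevel_psi hi).comp conj)).symm

theorem partialSum_eq {f : ℕ → VilenkinGroup m → ℂ} (hf : Martingale f (filtration m) (haar m))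
    {N k : ℕ} (hk : k ≤ bigM m N) (x : VilenkinGroup m) :
    partialSum m f k x = ∫ y, f N y * dirichlet k x y ∂(haar m) := by
  unfold partialSum dirichlet
  simp_rw [mul_sum]
  rw [integral_finsetSum]
  · refine sum_congr rfl fun i hi => ?_
    rw [coeff_eq hf ((mem_range.1 hi).trans_le hk), ← integral_mul_const]
    exact integral_congr_ae (ae_of_all _ fun y => by ring)
  · intro i hi
    exact ((atLevel_of_martingale hf N).comp₂ (atLevel_psi ((mem_range.1 hi).trans_le hk))
      fun u v => u * (psi m i x * conj v)).integrable

theorem sum_partialSum_eq {f : ℕ → VilenkinGroup m → ℂ}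
    (hf : Martingale f (filtration m) (haar m)) {N n : ℕ} (hn : n ≤ bigM m N)
    (x : VilenkinGroup m) :
    ∑ k ∈ range n, partialSum m f k x = ∫ y, f N y * fejer n x y ∂(haar m) := by
  unfold fejer
  simp_rw [mul_sum]
  have hk {k : ℕ} (hk : k ∈ range n) : k ≤ bigM m N := (mem_range.1 hk).le.trans hn
  rw [integral_finsetSum]
  · exact sum_congr rfl fun k h => partialSum_eq hf (hk h) x
  · exact fun k h => ((atLevel_of_martingale hf N).comp₂ (atLevel_dirichlet (hk h) x)
      (· * ·)).integrable

/-! ### Stopped martingales -/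

/-- Some value of modulus greater than `c` is attained by `f^(0)`, or by `f^(k+1)` on the
interval `I_k(x)` for some `k ≤ i`. -/
def Hit (f : ℕ → VilenkinGroup m → ℂ) (c : ℝ) (i : ℕ) (x : VilenkinGroup m) : Prop :=
  c < ‖f 0 x‖ ∨ ∃ k ≤ i, ∃ y ∈ interval m k x, c < ‖f (k + 1) y‖

/-- The first hitting time of level `c` at `x` is `k`. -/
def FirstHit (f : ℕ → VilenkinGroup m → ℂ) (c : ℝ) (k : ℕ) (x : VilenkinGroup m) : Prop :=
  Hit f c k x ∧ ∀ i < k, ¬ Hit f c i x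

/-- The martingale `f^(N)` stopped just before its modulus exceeds `c`. -/
def stopped (f : ℕ → VilenkinGroup m → ℂ) (c : ℝ) (N : ℕ) (x : VilenkinGroup m) : ℂ :=
  {x | ‖f 0 x‖ ≤ c}.indicator (f 0) x
    + ∑ i ∈ range N, {x | ¬ Hit f c i x}.indicator (fun x => f (i + 1) x - f i x) x

theorem Hit.mono {f : ℕ → VilenkinGroup m → ℂ} {c : ℝ} {i j : ℕ} {x : VilenkinGroup m}
    (h : Hit f c i x) (hij : i ≤ j) : Hit f c j x :=
  h.imp_right fun ⟨k, hk, h'⟩ => ⟨k, hk.trans hij, h'⟩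

theorem Hit.anti {f : ℕ → VilenkinGroup m → ℂ} {c c' : ℝ} {i : ℕ} {x : VilenkinGroup m}
    (h : Hit f c' i x) (hc : c ≤ c') : Hit f c i x :=
  h.imp hc.trans_lt fun ⟨k, hk, y, hy, h'⟩ => ⟨k, hk, y, hy, hc.trans_lt h'⟩

theorem norm_le_of_not_hit {f : ℕ → VilenkinGroup m → ℂ} {c : ℝ} {i : ℕ} {x : VilenkinGroup m}
    (h : ¬ Hit f c i x) : ‖f 0 x‖ ≤ c := not_lt.1 fun h' => h (Or.inl h')

/-- Although f^(k+1) is inspected, it is inspected on all of I_k(x); thus hitting is decided one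
step ahead of the jump. -/
theorem atLevel_hit {f : ℕ → VilenkinGroup m → ℂ} (hlev : ∀ n, AtLevel n (f n)) (c : ℝ) (i : ℕ) :
    AtLevel i (Hit f c i) := by
  intro x y hy
  unfold Hit
  rw [hlev 0 x y fun j hj => absurd hj (by omega)]
  refine propext (or_congr_right (exists_congr fun k => and_congr_right fun hk =>
    exists_congr fun z => and_congr_left fun _ => ?_))
  have := interval_anti hk x hy
  exact ⟨fun h => interval_trans this h, fun h => interval_trans (interval_comm.1 this) h⟩

theorem atLevel_firstHit {f : ℕ → VilenkinGroup m → ℂ} (hlev : ∀ n, AtLevel n (f n)) (c : ℝ)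
    (k : ℕ) : AtLevel k (FirstHit f c k) := by
  intro x y hy
  unfold FirstHit
  rw [atLevel_hit hlev c k x y hy]
  refine propext (and_congr_right fun _ => forall₂_congr fun i hi => ?_)
  rw [(atLevel_hit hlev c i).mono hi.le x y hy]

theorem stopped_eq {f : ℕ → VilenkinGroup m → ℂ} {c : ℝ} {N : ℕ} {x : VilenkinGroup m}
    (h0 : ‖f 0 x‖ ≤ c) (h : ∀ i < N, ¬ Hit f c i x) : stopped f c N x = f N x := by
  rw [stopped, Set.indicator_of_mem (show x ∈ {x | ‖f 0 x‖ ≤ c} from h0),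
    sum_congr rfl fun i hi => Set.indicator_of_mem (h i (mem_range.1 hi)) _,
    sum_range_sub (fun i => f i x)]
  ring

/-- There is no overshoot: the increment from i to i + 1 is kept only if f^(i+1) is already known
not to exceed c on I_i(x). -/
theorem norm_stopped_le {f : ℕ → VilenkinGroup m → ℂ} {c : ℝ} (hc : 0 ≤ c) (N : ℕ)
    (x : VilenkinGroup m) : ‖stopped f c N x‖ ≤ c := by
  induction N with
  | zero =>
    rw [stopped, range_zero, sum_empty, add_zero]
    by_cases h : ‖f 0 x‖ ≤ c
    · rwa [Set.indicator_of_mem (show x ∈ {x | ‖f 0 x‖ ≤ c} from h)]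
    · rwa [Set.indicator_of_notMem (show x ∉ {x | ‖f 0 x‖ ≤ c} from h), norm_zero]
  | succ N ih =>
    by_cases h : Hit f c N x
    · rw [stopped, sum_range_succ,
        Set.indicator_of_notMem (show x ∉ {x | ¬ Hit f c N x} from fun h' => h' h), add_zero]
      exact ih
    · rw [stopped_eq (norm_le_of_not_hit h) fun i hi h' => h (h'.mono (Nat.lt_succ_iff.1 hi))]
      exact not_lt.1 fun h' => h (Or.inr ⟨N, le_rfl, x, self_mem_interval N x, h'⟩)

/-- The difference of two stopped martingales on the first hitting intervals has mean zero. -/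
theorem integral_indicator_stopped_sub {f : ℕ → VilenkinGroup m → ℂ}
    (hf : Martingale f (filtration m) (haar m)) {c c' : ℝ} (hc : c ≤ c') {k N : ℕ} (hk : k ≠ 0)
    {z : VilenkinGroup m} (hz : FirstHit f c k z) :
    ∫ x, (interval m k z).indicator (fun x => stopped f c' N x - stopped f c N x) x ∂(haar m)
      = 0 := by
  classical
  have hlev := atLevel_of_martingale hf
  -- On I_k(z) the increments before time k occur in both stopped martingales and cancel. From k on
  -- the one for c is frozen, so the difference is a martingale transform with multipliers `h i` of
  -- level i.
  set h : ℕ → VilenkinGroup m → ℂ := fun i x =>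
    if k ≤ i then (if x ∈ interval m k z ∧ ¬ Hit f c' i x then 1 else 0) else 0 with hdef
  have hh (i : ℕ) : AtLevel i (h i) := by
    by_cases hi : k ≤ i
    · intro x y hy
      simp only [hdef, if_pos hi]
      have h1 := atLevel_mem_interval hi z x y hy
      have h2 := atLevel_hit hlev c' i x y hy
      simp only [h1, h2]
    · simp only [hdef, if_neg hi]
      exact atLevel_const i 0
  have hrep (x : VilenkinGroup m) :
      (interval m k z).indicator (fun x => stopped f c' N x - stopped f c N x) x
        = ∑ i ∈ range N, (f (i + 1) x - f i x) * h i x := by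
    by_cases hx : x ∈ interval m k z
    · have hx1 : FirstHit f c k x := by rwa [atLevel_firstHit hlev c k z x hx]
      -- Here k ≠ 0 matters: time 0 precedes the hit, so both stopped martingales keep f^(0), which
      -- then cancels.
      have h0 := norm_le_of_not_hit (hx1.2 0 (Nat.pos_of_ne_zero hk))
      rw [Set.indicator_of_mem hx, stopped, stopped,
        Set.indicator_of_mem (show x ∈ {x | ‖f 0 x‖ ≤ c} from h0),
        Set.indicator_of_mem (show x ∈ {x | ‖f 0 x‖ ≤ c'} from h0.trans hc),
        add_sub_add_left_eq_sub, ← sum_sub_distrib]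
      refine sum_congr rfl fun i _ => ?_
      by_cases hi : k ≤ i
      · have h1 : Hit f c i x := hx1.1.mono hi
        by_cases h2 : Hit f c' i x <;> simp [Set.indicator, hdef, hi, h1, h2, hx]
      · have h1 : ¬ Hit f c i x := hx1.2 i (not_le.1 hi)
        have h2 : ¬ Hit f c' i x := fun h2 => h1 (h2.anti hc)
        simp [Set.indicator, hdef, hi, h1, h2]
    · rw [Set.indicator_of_notMem hx]
      exact (sum_eq_zero fun i _ => by simp [hdef, hx]).symm
  simp_rw [hrep]
  rw [integral_finsetSum]
  · exact sum_eq_zero fun i _ => integral_martingale_diff_mul hf (hh i)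
  · intro i _
    exact (((hlev (i + 1)).comp₂ ((hlev i).mono (Nat.le_succ i)) (· - ·)).comp₂
      ((hh i).mono (Nat.le_succ i)) (· * ·)).integrable

/-! ### Hitting intervals -/

open Classical in
/-- The intervals `I_k(z)`, `k < N`, on which the level `c` is hit first at time `k`. -/
def hitCells (f : ℕ → VilenkinGroup m → ℂ) (c : ℝ) (N : ℕ) : Finset (ℕ × VilenkinGroup m) :=
  (range N ×ˢ reps m N).filter fun p => trunc p.1 p.2 = p.2 ∧ FirstHit f c p.1 p.2

theorem mem_hitCells {f : ℕ → VilenkinGroup m → ℂ} {c : ℝ} {N : ℕ} {p : ℕ × VilenkinGroup m} :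
    p ∈ hitCells f c N ↔ p.1 < N ∧ trunc p.1 p.2 = p.2 ∧ FirstHit f c p.1 p.2 := by
  simp only [hitCells, mem_filter, mem_product, mem_range, and_assoc]
  refine and_congr_right fun h => and_iff_right_of_imp fun h' => mem_reps.2 ?_
  rw [← h'.1, trunc_trunc_of_le h.le]

/-- A point where c is hit before time N has a unique first hitting time k, and the only cell
containing it is I_k of that point. -/
theorem sum_hitCells {E : Type*} [AddCommMonoid E] {f : ℕ → VilenkinGroup m → ℂ}
    (hlev : ∀ n, AtLevel n (f n)) (c : ℝ) (N : ℕ) (u : VilenkinGroup m → E)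
    (x : VilenkinGroup m) :
    ∑ p ∈ hitCells f c N, (interval m p.1 p.2).indicator u x
      = {x | ∃ k < N, Hit f c k x}.indicator u x := by
  classical
  by_cases h : ∃ k < N, Hit f c k x
  · rw [Set.indicator_of_mem (show x ∈ {x | ∃ k < N, Hit f c k x} from h)]
    have hex : ∃ k, Hit f c k x := h.imp fun _ => And.right
    obtain ⟨k₁, hk₁, hk₁'⟩ := h
    have hlt : Nat.find hex < N := (Nat.find_min' hex hk₁').trans_lt hk₁
    have hfirst : FirstHit f c (Nat.find hex) x :=
      ⟨Nat.find_spec hex, fun i hi => Nat.find_min hex hi⟩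
    rw [sum_eq_single (Nat.find hex, trunc (Nat.find hex) x)]
    · exact Set.indicator_of_mem (interval_comm.1 (trunc_mem _ x)) _
    · rintro ⟨k, z⟩ hp hne
      obtain ⟨-, hp1, hp2⟩ := mem_hitCells.1 hp
      refine Set.indicator_of_notMem (fun hx => hne ?_) _
      have hx1 : FirstHit f c k x := by rwa [atLevel_firstHit hlev c k z x hx]
      have hk : k = Nat.find hex := ((Nat.find_eq_iff hex).2 hx1).symm
      have hz : z = trunc k x := eq_trunc_of_mem (mem_reps.2 hp1) hx
      rw [← hk, ← hz]
    · intro hcon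
      refine absurd (mem_hitCells.2 ⟨hlt, trunc_trunc_of_le le_rfl x, ?_⟩) hcon
      simp only
      rwa [atLevel_firstHit hlev c _ x _ (trunc_mem _ x)]
  · rw [Set.indicator_of_notMem (show x ∉ {x | ∃ k < N, Hit f c k x} from h)]
    refine sum_eq_zero fun p hp => Set.indicator_of_notMem (fun hx => h ?_) _
    obtain ⟨hp0, -, hp2⟩ := mem_hitCells.1 hp
    have hx1 : FirstHit f c p.1 x := by rwa [atLevel_firstHit hlev c _ p.2 x hx]
    exact ⟨p.1, hp0, hx1.1⟩

/-- The total measure of the hitting intervals is controlled by the maximal function. -/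
theorem sum_haar_hitCells_le {B : ℕ} (hB : ∀ k, m k ≤ B) {f : ℕ → VilenkinGroup m → ℂ}
    (hlev : ∀ n, AtLevel n (f n)) (c : ℝ) (N : ℕ) :
    ∑ p ∈ hitCells f c N, (bigM m p.1 : ℝ)⁻¹
      ≤ B * (haar m).real {x | ∃ n ≤ N, c < ‖f n x‖} := by
  set S : Set (VilenkinGroup m) := {x | ∃ n ≤ N, c < ‖f n x‖} with hS
  have hSm : MeasurableSet S := by
    refine AtLevel.measurableSet (n := N) fun x y hy => ?_
    refine propext (exists_congr fun n => and_congr_right fun hn => ?_)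
    rw [(hlev n).mono hn x y hy]
  have hcell (p : ℕ × VilenkinGroup m) (hp : p ∈ hitCells f c N) :
      (bigM m p.1 : ℝ)⁻¹ ≤ B * (haar m).real (interval m p.1 p.2 ∩ S) := by
    obtain ⟨hp0, -, hp2⟩ := mem_hitCells.1 hp
    -- Each cell of level k contains an interval of level k + 1 on which c is exceeded; this is a
    -- proportion 1/m_k ≥ 1/B of the cell. As the cells are disjoint, the proportions add up inside
    -- S.
    have hsub : ∃ y, interval m (p.1 + 1) y ⊆ interval m p.1 p.2 ∩ S := by
      rcases hp2.1 with h | ⟨k, hk, y, hy, hlt⟩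
      · refine ⟨p.2, fun x hx => ⟨interval_anti (Nat.le_succ _) _ hx, 0, Nat.zero_le _, ?_⟩⟩
        rwa [hlev 0 p.2 x fun j hj => absurd hj (by omega)]
      · have hkp : k = p.1 := by
          by_contra hne
          exact hp2.2 k (lt_of_le_of_ne hk hne) (Or.inr ⟨k, le_rfl, y, hy, hlt⟩)
        subst hkp
        refine ⟨y, fun x hx => ⟨interval_trans hy (interval_anti (Nat.le_succ _) _ hx),
          p.1 + 1, hp0, ?_⟩⟩
        rwa [hlev _ y x hx]
    obtain ⟨y, hy⟩ := hsub
    have h1 := measureReal_mono (μ := haar m) hy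
    rw [haar_interval, bigM_succ] at h1
    refine le_trans ?_ (mul_le_mul_of_nonneg_left h1 (Nat.cast_nonneg B))
    have hmp : (0 : ℝ) < m p.1 := by exact_mod_cast Nat.pos_of_neZero (m p.1)
    have hmB : (m p.1 : ℝ) ≤ B := by exact_mod_cast hB p.1
    have hM := bigM_cast_pos (m := m) p.1
    push_cast
    rw [mul_inv, ← mul_assoc]
    refine le_mul_of_one_le_left (by positivity) ?_
    rwa [← div_eq_mul_inv, one_le_div hmp]
  refine (sum_le_sum hcell).trans ?_
  rw [← mul_sum]
  gcongr
  have h1 (p : ℕ × VilenkinGroup m) : (haar m).real (interval m p.1 p.2 ∩ S)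
      = ∫ x, (interval m p.1 p.2).indicator (S.indicator fun _ => (1 : ℝ)) x ∂(haar m) := by
    rw [Set.indicator_indicator, integral_indicator_const _
      ((measurableSet_interval m _ _).inter hSm)]
    simp
  simp_rw [h1]
  rw [← integral_finsetSum _ fun p _ =>
    ((integrable_const _).indicator hSm).indicator (measurableSet_interval m _ _)]
  simp_rw [sum_hitCells hlev]
  rw [← integral_indicator_one hSm]
  refine integral_mono_of_nonneg (ae_of_all _ fun x => ?_) ((integrable_const _).indicator hSm)
    (ae_of_all _ fun x => ?_)
  · exact Set.indicator_nonneg (fun _ _ => Set.indicator_nonneg (fun _ _ => zero_le_one) _) _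
  · exact Set.indicator_le_self' (fun _ _ => Set.indicator_nonneg (fun _ _ => zero_le_one) _) _
/-! ### The maximal operator of the Fejér means -/

theorem atLevel_stopped {f : ℕ → VilenkinGroup m → ℂ} (hlev : ∀ n, AtLevel n (f n)) (c : ℝ)
    (N : ℕ) : AtLevel N (stopped f c N) := by
  classical
  have h1 : AtLevel N ({x | ‖f 0 x‖ ≤ c}.indicator (f 0)) :=
    (((hlev 0).comp fun w => if ‖w‖ ≤ c then w else 0).mono (Nat.zero_le N))
  refine h1.comp₂ (AtLevel.sum fun i hi => ?_) (· + ·)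
  have hi' := mem_range.1 hi
  exact ((((hlev (i + 1)).mono hi').comp₂ ((hlev i).mono hi'.le) (· - ·)).comp₂
    ((atLevel_hit hlev c i).mono hi'.le) fun w P => {_u : Unit | ¬ P}.indicator (fun _ => w) ())

theorem atLevel_indicator {k N : ℕ} (hk : k ≤ N) (z : VilenkinGroup m) {g : VilenkinGroup m → ℂ}
    (hg : AtLevel N g) : AtLevel N ((interval m k z).indicator g) := by
  classical
  exact hg.comp₂ (atLevel_mem_interval hk z) fun w P => if P then w else 0

theorem totalWeight_zero (z x : VilenkinGroup m) : totalWeight 0 z x = 1 := by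
  simp [totalWeight, weight, bigM, Set.indicator, box]

/-- Decomposition of a martingale along a finite increasing sequence of levels. -/
theorem eq_stopped_add_sum {f : ℕ → VilenkinGroup m → ℂ} (hlev : ∀ n, AtLevel n (f n))
    {c : ℕ → ℝ} (hc : Monotone c) {N J : ℕ} (hN : 1 ≤ N)
    (hJ : ∀ n ≤ N, ∀ x, ‖f n x‖ ≤ c J) (x : VilenkinGroup m) :
    f N x = stopped f (c 0) N x + ∑ j ∈ range J, ∑ p ∈ hitCells f (c j) N,
      (interval m p.1 p.2).indicator
        (fun x => stopped f (c (j + 1)) N x - stopped f (c j) N x) x := by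
  have hlast : stopped f (c J) N x = f N x := by
    refine stopped_eq (hJ 0 (Nat.zero_le N) x) fun i hi => ?_
    rintro (h | ⟨k, hk, y, -, h⟩)
    · exact absurd h (not_lt.2 (hJ 0 (Nat.zero_le N) x))
    · exact absurd h (not_lt.2 (hJ (k + 1) (by omega) y))
  have hj (j : ℕ) : ∑ p ∈ hitCells f (c j) N, (interval m p.1 p.2).indicator
        (fun x => stopped f (c (j + 1)) N x - stopped f (c j) N x) x
      = stopped f (c (j + 1)) N x - stopped f (c j) N x := by
    rw [sum_hitCells hlev]
    by_cases h : ∃ k < N, Hit f (c j) k x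
    · exact Set.indicator_of_mem (show x ∈ {x | ∃ k < N, Hit f (c j) k x} from h) _
    · rw [Set.indicator_of_notMem (show x ∉ {x | ∃ k < N, Hit f (c j) k x} from h)]
      push Not at h
      have h0 := norm_le_of_not_hit (h 0 hN)
      have hle : c j ≤ c (j + 1) := hc (Nat.le_succ j)
      rw [stopped_eq h0 h, stopped_eq (h0.trans hle) fun i hi h' => h i hi (h'.anti hle), sub_self]
  simp_rw [hj]
  rw [sum_range_sub (fun j => stopped f (c j) N x), hlast]
  ring

/-- The coefficient of an atom of height comparable with `c` on an interval of level `k`. -/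
theorem norm_integral_martingale_mul_fejer_le {B : ℕ} (hB : ∀ k, m k ≤ B)
    {f : ℕ → VilenkinGroup m → ℂ} (hf : Martingale f (filtration m) (haar m))
    {c : ℕ → ℝ} (hc0 : ∀ j, 0 ≤ c j) (hc : Monotone c) {N J : ℕ} (hN : 1 ≤ N)
    (hJ : ∀ n ≤ N, ∀ x, ‖f n x‖ ≤ c J) {n : ℕ} (hn : 1 ≤ n) (hnN : n ≤ bigM m N)
    (x : VilenkinGroup m) :
    ‖∫ y, f N y * fejer n x y ∂(haar m)‖
      ≤ n * (12 * B ^ 3 * (c 0 + ∑ j ∈ range J, ∑ p ∈ hitCells f (c j) N,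
        (c (j + 1) + c j) * ((bigM m p.1 : ℝ)⁻¹ ^ 2 * totalWeight p.1 p.2 x))) := by
  have hlev := atLevel_of_martingale hf
  set b : ℕ → ℕ × VilenkinGroup m → VilenkinGroup m → ℂ := fun j p =>
    (interval m p.1 p.2).indicator
      (fun x => stopped f (c (j + 1)) N x - stopped f (c j) N x) with hb
  have hblev (j : ℕ) {p : ℕ × VilenkinGroup m} (hp : p ∈ hitCells f (c j) N) :
      AtLevel N (b j p) :=
    atLevel_indicator (mem_hitCells.1 hp).1.le p.2
      ((atLevel_stopped hlev _ N).comp₂ (atLevel_stopped hlev _ N) (· - ·))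
  have hint {g : VilenkinGroup m → ℂ} (hg : AtLevel N g) :
      Integrable (fun y => g y * fejer n x y) (haar m) :=
    (hg.comp₂ (atLevel_fejer hnN x) (· * ·)).integrable
  have hdecomp : ∫ y, f N y * fejer n x y ∂(haar m)
      = ∫ y, stopped f (c 0) N y * fejer n x y ∂(haar m)
        + ∑ j ∈ range J, ∑ p ∈ hitCells f (c j) N, ∫ y, b j p y * fejer n x y ∂(haar m) := by
    have h1 (y : VilenkinGroup m) : f N y * fejer n x y = stopped f (c 0) N y * fejer n x y
        + ∑ j ∈ range J, ∑ p ∈ hitCells f (c j) N, b j p y * fejer n x y := by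
      simp_rw [← sum_mul]
      rw [← add_mul]
      congr 1
      exact eq_stopped_add_sum hlev hc hN hJ y
    simp_rw [h1]
    rw [integral_add (hint (atLevel_stopped hlev _ N)) (integrable_finsetSum _ fun j _ =>
      integrable_finsetSum _ fun p hp => hint (hblev j hp)),
      integral_finsetSum _ fun j _ => integrable_finsetSum _ fun p hp => hint (hblev j hp)]
    congr 1
    exact sum_congr rfl fun j _ => integral_finsetSum _ fun p hp => hint (hblev j hp)
  -- The part stopped at the lowest height counts as an atom on I_0, the whole group, where
  -- `totalWeight` is 1 and no mean value condition is needed.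
  have hfirst : ‖∫ y, stopped f (c 0) N y * fejer n x y ∂(haar m)‖
      ≤ n * (12 * B ^ 3 * c 0) := by
    refine (norm_integral_mul_fejer_le hB hn (k := 0) (z := x)
      (fun y => norm_stopped_le (hc0 0) N y) (fun y hy => ?_) (Or.inl rfl) x).trans (le_of_eq ?_)
    · exact absurd (fun j hj => absurd hj (by omega)) hy
    · simp [totalWeight_zero, bigM]
  have hatom (j : ℕ) {p : ℕ × VilenkinGroup m} (hp : p ∈ hitCells f (c j) N) :
      ‖∫ y, b j p y * fejer n x y ∂(haar m)‖ ≤ n * (12 * B ^ 3 * ((c (j + 1) + c j)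
        * ((bigM m p.1 : ℝ)⁻¹ ^ 2 * totalWeight p.1 p.2 x))) := by
    refine (norm_integral_mul_fejer_le hB hn (k := p.1) (z := p.2) (β := c (j + 1) + c j)
      (fun y => ?_) (fun y hy => Set.indicator_of_notMem hy _) ?_ x).trans (le_of_eq (by ring))
    · refine (norm_indicator_le_norm_self _ _).trans ((norm_sub_le _ _).trans ?_)
      exact add_le_add (norm_stopped_le (hc0 _) N y) (norm_stopped_le (hc0 _) N y)
    · rcases Nat.eq_zero_or_pos p.1 with h | h
      · exact Or.inl h
      · exact Or.inr (integral_indicator_stopped_sub hf (hc (Nat.le_succ j)) h.ne'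
          (mem_hitCells.1 hp).2.2)
  rw [hdecomp, mul_add, mul_add]
  refine (norm_add_le _ _).trans (add_le_add hfirst ?_)
  rw [mul_sum, mul_sum]
  refine (norm_sum_le _ _).trans (sum_le_sum fun j _ => ?_)
  rw [mul_sum, mul_sum]
  exact (norm_sum_le _ _).trans (sum_le_sum fun p hp => hatom j hp)

theorem measurable_totalWeight (k : ℕ) (z : VilenkinGroup m) : Measurable (totalWeight k z) :=
  Finset.measurable_sum _ fun A _ => (atLevel_weight A z).measurable

/-- The weak type bound for a multiple of a weight. -/
theorem measure_const_mul_totalWeight_le {B : ℕ} (hB : ∀ k, m k ≤ B) (k : ℕ)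
    (z : VilenkinGroup m) {d : ℝ} (hd : 0 ≤ d) {r : ℝ} (hr : 0 < r) :
    (haar m).real {x | r < d ^ 2 * totalWeight k z x} * √r ≤ 2 * (1 + 2 * B) * d := by
  rcases hd.eq_or_lt with rfl | hd
  · have : {x | r < (0 : ℝ) ^ 2 * totalWeight k z x} = ∅ :=
      Set.eq_empty_of_forall_notMem fun x hx => by
        simp only [Set.mem_ofPred_eq] at hx
        linarith
    rw [this]; simp
  -- Rescaling: ρ = r / (4 d^2) turns the threshold r for d^2 times the weight into 4 ρ for the
  -- weight, and √r = 2 d √ρ.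
  · have hρ : 0 < r / (4 * d ^ 2) := by positivity
    have h := measure_totalWeight_le hB k z hρ
    have hset : {x | r < d ^ 2 * totalWeight k z x}
        = {x | 4 * (r / (4 * d ^ 2)) < totalWeight k z x} := by
      ext x
      simp only [Set.mem_ofPred_eq]
      rw [show 4 * (r / (4 * d ^ 2)) = r / d ^ 2 by field_simp, div_lt_iff₀' (by positivity)]
    have hsq : √r = √(r / (4 * d ^ 2)) * (2 * d) := by
      rw [show r / (4 * d ^ 2) = r / (2 * d) ^ 2 by ring, Real.sqrt_div' _ (by positivity),
        Real.sqrt_sq (by positivity)]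
      field_simp
    rw [hset, hsq, ← mul_assoc]
    calc _ ≤ (1 + 2 * B) * (2 * d) := by gcongr
      _ = _ := by ring

/-- The terms present are those with s 2^j below the square root of Y, and a geometric sum is at
most twice its largest term. -/
theorem sum_geometric_indicator_le {s : ℝ} (hs : 0 ≤ s) (Y : ℝ≥0∞) (J : ℕ) :
    ∑ j ∈ range J, (if ENNReal.ofReal ((s * 2 ^ j) ^ 2) < Y then ENNReal.ofReal (s * 2 ^ j) else 0)
      ≤ 2 * Y ^ (1 / 2 : ℝ) := by
  have hgeom (J : ℕ) : ∑ j ∈ range (J + 1), ENNReal.ofReal (s * 2 ^ j)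
      ≤ 2 * ENNReal.ofReal (s * 2 ^ J) := by
    induction J with
    | zero => simp only [zero_add, range_one, sum_singleton]; exact le_mul_of_one_le_left' one_le_two
    | succ J ih =>
      rw [sum_range_succ]
      have : 2 * ENNReal.ofReal (s * 2 ^ J) = ENNReal.ofReal (s * 2 ^ (J + 1)) := by
        rw [pow_succ, ← mul_assoc, ENNReal.ofReal_mul (p := s * 2 ^ J) (by positivity),
          ENNReal.ofReal_ofNat, mul_comm]
      rw [this] at ih
      calc _ ≤ ENNReal.ofReal (s * 2 ^ (J + 1)) + ENNReal.ofReal (s * 2 ^ (J + 1)) := by gcongr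
        _ = _ := (two_mul _).symm
  induction J with
  | zero => simp
  | succ J ih =>
    by_cases h : ENNReal.ofReal ((s * 2 ^ J) ^ 2) < Y
    · calc _ ≤ ∑ j ∈ range (J + 1), ENNReal.ofReal (s * 2 ^ j) :=
            sum_le_sum fun j _ => by split_ifs <;> simp
        _ ≤ 2 * ENNReal.ofReal (s * 2 ^ J) := hgeom J
        _ ≤ _ := by
          gcongr
          calc ENNReal.ofReal (s * 2 ^ J)
              = (ENNReal.ofReal ((s * 2 ^ J) ^ 2)) ^ (1 / 2 : ℝ) := by
                rw [ENNReal.ofReal_pow (by positivity), ← ENNReal.rpow_natCast,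
                  ← ENNReal.rpow_mul]
                norm_num
            _ ≤ _ := by gcongr
    · rw [sum_range_succ, if_neg h, add_zero]
      exact ih

theorem measurable_maximalFunction {f : ℕ → VilenkinGroup m → ℂ}
    (hlev : ∀ n, AtLevel n (f n)) : Measurable (maximalFunction m f) :=
  Measurable.iSup fun n => (hlev n).measurable.enorm

/-- A dyadic layer cake formula, obtained by integrating `sum_geometric_indicator_le` with Y = f^*.
-/
theorem sum_level_measure_le {f : ℕ → VilenkinGroup m → ℂ} (hlev : ∀ n, AtLevel n (f n))
    {s : ℝ} (hs : 0 ≤ s) (N J : ℕ) :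
    ∑ j ∈ range J, ENNReal.ofReal (s * 2 ^ j) * haar m {x | ∃ n ≤ N, (s * 2 ^ j) ^ 2 < ‖f n x‖}
      ≤ 2 * ∫⁻ x, maximalFunction m f x ^ (1 / 2 : ℝ) ∂(haar m) := by
  have hmeas (j : ℕ) : MeasurableSet {x | ENNReal.ofReal ((s * 2 ^ j) ^ 2)
      < maximalFunction m f x} :=
    measurableSet_lt measurable_const (measurable_maximalFunction hlev)
  have hle (j : ℕ) : ENNReal.ofReal (s * 2 ^ j)
        * haar m {x | ∃ n ≤ N, (s * 2 ^ j) ^ 2 < ‖f n x‖}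
      ≤ ∫⁻ x, (if ENNReal.ofReal ((s * 2 ^ j) ^ 2) < maximalFunction m f x
        then ENNReal.ofReal (s * 2 ^ j) else 0) ∂(haar m) := by
    have h1 : (fun x => if ENNReal.ofReal ((s * 2 ^ j) ^ 2) < maximalFunction m f x
        then ENNReal.ofReal (s * 2 ^ j) else 0)
        = {x | ENNReal.ofReal ((s * 2 ^ j) ^ 2) < maximalFunction m f x}.indicator
          fun _ => ENNReal.ofReal (s * 2 ^ j) := by
      ext x; simp [Set.indicator]
    rw [h1, lintegral_indicator_const (hmeas j)]
    refine mul_le_mul' le_rfl (measure_mono ?_)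
    rintro x ⟨n, -, hx⟩
    refine lt_of_lt_of_le ?_ (le_iSup (fun n => ‖f n x‖ₑ) n)
    rw [← ofReal_norm]
    exact (ENNReal.ofReal_lt_ofReal_iff_of_nonneg (by positivity)).2 hx
  refine (sum_le_sum fun j _ => hle j).trans ?_
  rw [← lintegral_finsetSum _ fun j _ => Measurable.ite (hmeas j) measurable_const measurable_const,
    ← lintegral_const_mul _ ((measurable_maximalFunction hlev).pow_const _)]
  exact lintegral_mono fun x => sum_geometric_indicator_le hs _ J

/-- Weak type bound for the maximal Fejér means of order at most `M_N`. -/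
theorem measure_fejer_maximal_le {B : ℕ} (hB : ∀ k, m k ≤ B)
    {f : ℕ → VilenkinGroup m → ℂ} (hf : Martingale f (filtration m) (haar m)) {N : ℕ}
    (hN : 1 ≤ N) {s : ℝ} (hs : 0 < s) :
    haar m {x | ∃ n, 1 ≤ n ∧ n ≤ bigM m N ∧
        n * (24 * B ^ 3 * s ^ 2) < ‖∑ k ∈ range n, partialSum m f k x‖} * ENNReal.ofReal s
      ≤ ENNReal.ofReal (36 * (1 + 2 * B) * B)
        * ∫⁻ x, maximalFunction m f x ^ (1 / 2 : ℝ) ∂(haar m) := by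
  have hlev := atLevel_of_martingale hf
  have hB1 : (1 : ℝ) ≤ B := by exact_mod_cast le_trans (Nat.pos_of_neZero (m 0)) (hB 0)
  -- The lowest height c 0 = s^2 uses up exactly half of the threshold 24 B^3 s^2, leaving 12 B^3
  -- s^2 to be exceeded by the atoms.
  set c : ℕ → ℝ := fun j => (s * 2 ^ j) ^ 2 with hcdef
  have hc0 (j : ℕ) : 0 ≤ c j := by positivity
  have hc : Monotone c := fun i j hij => by
    simp only [hcdef]
    gcongr
    norm_num
  obtain ⟨J, hJ⟩ : ∃ J, ∀ n ≤ N, ∀ x, ‖f n x‖ ≤ c J := by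
    choose C hC using fun n => (hlev n).exists_bound
    obtain ⟨D, hD⟩ := ((range (N + 1)).image C).exists_le
    have htend : Tendsto c atTop atTop := by
      have : Tendsto (fun j : ℕ => s * (2 : ℝ) ^ j) atTop atTop :=
        (tendsto_pow_atTop_atTop_of_one_lt one_lt_two).const_mul_atTop hs
      exact (tendsto_pow_atTop two_ne_zero).comp this
    obtain ⟨J, hJ⟩ := (htend.eventually_ge_atTop D).exists
    exact ⟨J, fun n hn x => (hC n x).trans ((hD _ (mem_image_of_mem _
      (mem_range.2 (Nat.lt_succ_of_le hn)))).trans hJ)⟩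
  set S : Finset (Σ _ : ℕ, ℕ × VilenkinGroup m) :=
    (range J).sigma fun j => hitCells f (c j) N with hS
  -- The factor 3 comes from c (j + 1) + c j = 5 (s 2^j)^2 ≤ (3 s 2^j)^2. Up to a constant, d is s
  -- 2^j times the measure of the cell.
  set d : (Σ _ : ℕ, ℕ × VilenkinGroup m) → ℝ := fun q =>
    3 * (s * 2 ^ q.1) * (bigM m q.2.1 : ℝ)⁻¹ with hd
  have hd0 (q) : 0 ≤ d q := by positivity
  set F : (Σ _ : ℕ, ℕ × VilenkinGroup m) → VilenkinGroup m → ℝ := fun q x =>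
    d q ^ 2 * totalWeight q.2.1 q.2.2 x with hF
  have hsub : {x | ∃ n, 1 ≤ n ∧ n ≤ bigM m N ∧
        n * (24 * B ^ 3 * s ^ 2) < ‖∑ k ∈ range n, partialSum m f k x‖}
      ⊆ {x | s ^ 2 < ∑ q ∈ S, F q x} := by
    rintro x ⟨n, hn, hnN, hlt⟩
    rw [sum_partialSum_eq hf hnN] at hlt
    have h1 := hlt.trans_le (norm_integral_martingale_mul_fejer_le hB hf hc0 hc hN hJ hn hnN x)
    have hn0 : (0 : ℝ) < n := by exact_mod_cast hn
    have h2 := lt_of_mul_lt_mul_left h1 hn0.le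
    have h3 : 12 * (B : ℝ) ^ 3 * (2 * s ^ 2) < 12 * (B : ℝ) ^ 3 * (c 0 + ∑ j ∈ range J,
        ∑ p ∈ hitCells f (c j) N,
        (c (j + 1) + c j) * ((bigM m p.1 : ℝ)⁻¹ ^ 2 * totalWeight p.1 p.2 x)) := by linarith
    have h4 := lt_of_mul_lt_mul_left h3 (by positivity)
    have h5 : c 0 = s ^ 2 := by simp [hcdef]
    have h6 : ∑ j ∈ range J, ∑ p ∈ hitCells f (c j) N,
        (c (j + 1) + c j) * ((bigM m p.1 : ℝ)⁻¹ ^ 2 * totalWeight p.1 p.2 x)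
        ≤ ∑ q ∈ S, F q x := by
      rw [hS, sum_sigma]
      refine sum_le_sum fun j _ => sum_le_sum fun p _ => ?_
      have h7 : c (j + 1) + c j ≤ (3 * (s * 2 ^ j)) ^ 2 := by
        simp only [hcdef, pow_succ (2 : ℝ) j]
        nlinarith [sq_nonneg (s * 2 ^ j)]
      simp only [hF, hd]
      rw [mul_pow (3 * (s * 2 ^ j)), mul_assoc]
      have := totalWeight_nonneg p.1 p.2 x
      gcongr
    simp only [Set.mem_ofPred_eq]
    linarith
  have hweak := measure_sum_gt_le (μ := haar m) (s := S) (F := F)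
    (a := fun q => 2 * (1 + 2 * B) * d q) (t := s ^ 2)
    (fun q _ => (measurable_totalWeight _ _).const_mul _)
    (fun q _ x => mul_nonneg (sq_nonneg _) (totalWeight_nonneg _ _ _))
    (fun q _ r hr => measure_const_mul_totalWeight_le hB _ _ (hd0 q) hr) (by positivity)
  rw [Real.sqrt_sq hs.le] at hweak
  have hsum : ∑ q ∈ S, 2 * (1 + 2 * B) * d q ≤ 6 * (1 + 2 * B) * B * ∑ j ∈ range J,
      s * 2 ^ j * (haar m).real {x | ∃ n ≤ N, c j < ‖f n x‖} := by
    rw [hS, sum_sigma, mul_sum]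
    refine sum_le_sum fun j _ => ?_
    have h1 := sum_haar_hitCells_le hB hlev (c j) N
    simp only [hd]
    rw [← mul_sum, ← mul_sum]
    calc _ ≤ 2 * (1 + 2 * (B : ℝ)) * (3 * (s * 2 ^ j)
          * (B * (haar m).real {x | ∃ n ≤ N, c j < ‖f n x‖})) := by gcongr
      _ = _ := by ring
  have hreal : (haar m).real {x | s ^ 2 < ∑ q ∈ S, F q x} * s ≤ 18 * (1 + 2 * B) * B
      * ∑ j ∈ range J, s * 2 ^ j * (haar m).real {x | ∃ n ≤ N, c j < ‖f n x‖} := by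
    linarith
  calc _ ≤ haar m {x | s ^ 2 < ∑ q ∈ S, F q x} * ENNReal.ofReal s := by gcongr
    _ = ENNReal.ofReal ((haar m).real {x | s ^ 2 < ∑ q ∈ S, F q x} * s) := by
        rw [ENNReal.ofReal_mul measureReal_nonneg, ofReal_measureReal]
    _ ≤ ENNReal.ofReal (18 * (1 + 2 * B) * B
          * ∑ j ∈ range J, s * 2 ^ j * (haar m).real {x | ∃ n ≤ N, c j < ‖f n x‖}) :=
        ENNReal.ofReal_le_ofReal hreal
    _ = ENNReal.ofReal (18 * (1 + 2 * B) * B) * ∑ j ∈ range J,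
          ENNReal.ofReal (s * 2 ^ j) * haar m {x | ∃ n ≤ N, c j < ‖f n x‖} := by
        rw [ENNReal.ofReal_mul (by positivity), ENNReal.ofReal_sum_of_nonneg fun j _ => by positivity]
        congr 1
        refine sum_congr rfl fun j _ => ?_
        rw [ENNReal.ofReal_mul (by positivity), ofReal_measureReal]
    _ ≤ ENNReal.ofReal (18 * (1 + 2 * B) * B)
          * (2 * ∫⁻ x, maximalFunction m f x ^ (1 / 2 : ℝ) ∂(haar m)) := by
        gcongr
        exact sum_level_measure_le hlev hs.le N J
    _ = _ := by
        rw [← mul_assoc, show (2 : ℝ≥0∞) = ENNReal.ofReal 2 by simp,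
          ← ENNReal.ofReal_mul (by positivity)]
        congr 2
        ring

/-! ### The `T` means -/

/-- Abel summation: the boundary term and the telescoping variation of q contribute q_{n-1} +
(q_{n-1} - q_0) ≤ 2 q_{n-1}. -/
theorem norm_sum_mul_le_of_monotone {q : ℕ → ℝ} (hq0 : 0 ≤ q 0) (hq : Monotone q) {u : ℕ → ℂ}
    {D : ℝ} {n : ℕ} (hn : 1 ≤ n)
    (hu : ∀ j, 1 ≤ j → j ≤ n → ‖∑ k ∈ range j, u k‖ ≤ j * D) :
    ‖∑ k ∈ range n, (q k : ℂ) * u k‖ ≤ 2 * n * q (n - 1) * D := by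
  obtain ⟨n, rfl⟩ : ∃ k, n = k + 1 := ⟨n - 1, by omega⟩
  have habel (n : ℕ) : ∑ k ∈ range (n + 1), (q k : ℂ) * u k
      = q n * ∑ k ∈ range (n + 1), u k
        - ∑ j ∈ range n, ((q (j + 1) - q j : ℝ) : ℂ) * ∑ k ∈ range (j + 1), u k := by
    induction n with
    | zero => simp
    | succ n ih =>
      rw [sum_range_succ _ (n + 1), ih, sum_range_succ
        (fun j => ((q (j + 1) - q j : ℝ) : ℂ) * ∑ k ∈ range (j + 1), u k) n,
        sum_range_succ u (n + 1)]
      push_cast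
      ring
  have hD : 0 ≤ D := by
    have := (norm_nonneg _).trans (hu 1 le_rfl hn)
    simpa using this
  have hqn : 0 ≤ q n := hq0.trans (hq (Nat.zero_le n))
  rw [habel, Nat.add_sub_cancel]
  calc _ ≤ q n * ((n + 1 : ℕ) * D) + ∑ j ∈ range n, (q (j + 1) - q j) * ((n + 1 : ℕ) * D) := by
        refine (norm_sub_le _ _).trans (add_le_add ?_ ((norm_sum_le _ _).trans
          (sum_le_sum fun j hj => ?_)))
        · rw [norm_mul, Complex.norm_real, Real.norm_of_nonneg hqn]
          gcongr
          exact hu _ hn le_rfl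
        · have hj' := mem_range.1 hj
          have h1 : 0 ≤ q (j + 1) - q j := sub_nonneg.2 (hq (Nat.le_succ j))
          rw [norm_mul, Complex.norm_real, Real.norm_of_nonneg h1]
          gcongr
          refine (hu (j + 1) (by omega) (by omega)).trans ?_
          gcongr
    _ = (2 * q n - q 0) * ((n + 1 : ℕ) * D) := by
        rw [← sum_mul, sum_range_sub]
        ring
    _ ≤ 2 * q n * ((n + 1 : ℕ) * D) := by gcongr; linarith
    _ = _ := by ring

theorem bigQ_pos {q : ℕ → ℝ} (hq0 : 0 < q 0) (hq : Monotone q) {n : ℕ} (hn : 1 ≤ n) :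
    0 < bigQ q n :=
  sum_pos (fun k _ => hq0.trans_le (hq (Nat.zero_le k))) ⟨0, mem_range.2 hn⟩

theorem exists_ratio_bound {q : ℕ → ℝ} (hq0 : 0 < q 0) (hq : Monotone q)
    (hO : (fun n : ℕ => q (n - 1) / bigQ q n) =O[atTop] (fun n : ℕ => 1 / (n : ℝ))) :
    ∃ A, 0 < A ∧ ∀ n, 1 ≤ n → n * q (n - 1) / bigQ q n ≤ A := by
  obtain ⟨A, hA⟩ := hO.bound
  obtain ⟨n₀, hn₀⟩ := eventually_atTop.1 hA
  -- Below n₀, where the asymptotic bound says nothing, q_{n-1} ≤ Q_n gives the bound n ≤ n₀.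
  refine ⟨max (max A n₀) 1, by positivity, fun n hn => ?_⟩
  have hn0 : (0 : ℝ) < n := by exact_mod_cast hn
  have hQ := bigQ_pos hq0 hq hn
  rcases le_total n₀ n with h | h
  · have h1 := (le_abs_self _).trans (hn₀ n h)
    rw [Real.norm_of_nonneg (by positivity), mul_one_div, le_div_iff₀ hn0] at h1
    refine le_trans ?_ ((le_max_left A n₀).trans (le_max_left _ 1))
    refine le_trans (le_of_eq ?_) h1
    ring
  · refine le_trans ?_ ((le_max_right A n₀).trans (le_max_left _ 1))
    have h1 : q (n - 1) ≤ bigQ q n :=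
      single_le_sum (f := q) (fun k _ => (hq0.trans_le (hq (Nat.zero_le k))).le)
        (mem_range.2 (by omega))
    rw [mul_div_assoc]
    calc (n : ℝ) * (q (n - 1) / bigQ q n) ≤ n * 1 := by
          gcongr
          exact (div_le_one hQ).2 h1
      _ ≤ n₀ := by rw [mul_one]; exact_mod_cast h

theorem norm_tMean_le {q : ℕ → ℝ} (hq0 : 0 < q 0) (hq : Monotone q) {A : ℝ} (hA0 : 0 < A)
    (hA : ∀ n, 1 ≤ n → n * q (n - 1) / bigQ q n ≤ A) {f : ℕ → VilenkinGroup m → ℂ}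
    {n : ℕ} {D : ℝ} {x : VilenkinGroup m} (hD : 0 ≤ D)
    (h : ∀ j, 1 ≤ j → j ≤ n → ‖∑ k ∈ range j, partialSum m f k x‖ ≤ j * D) :
    ‖tMean m q f n x‖ ≤ 2 * A * D := by
  rcases Nat.eq_zero_or_pos n with rfl | hn
  · simp only [tMean, range_zero, sum_empty, mul_zero, norm_zero]
    positivity
  · have hQ := bigQ_pos hq0 hq hn
    rw [tMean, norm_mul, norm_div, norm_one, Complex.norm_real, Real.norm_of_nonneg hQ.le]
    calc _ ≤ 1 / bigQ q n * (2 * n * q (n - 1) * D) := by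
          gcongr
          exact norm_sum_mul_le_of_monotone hq0.le hq hn h
      _ = 2 * (n * q (n - 1) / bigQ q n) * D := by ring
      _ ≤ _ := by gcongr; exact hA n hn

/-- Weak type bound for the maximal operator of the `T` means. -/
theorem weak_tMax_le {B : ℕ} (hB : ∀ k, m k ≤ B) {q : ℕ → ℝ} (hq0 : 0 < q 0) (hq : Monotone q)
    {A : ℝ} (hA0 : 0 < A) (hA : ∀ n, 1 ≤ n → n * q (n - 1) / bigQ q n ≤ A)
    {f : ℕ → VilenkinGroup m → ℂ} (hf : Martingale f (filtration m) (haar m)) {s : ℝ}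
    (hs : 0 < s) :
    haar m {x | ENNReal.ofReal (48 * A * B ^ 3 * s ^ 2) < tMax m q f x} * ENNReal.ofReal s
      ≤ ENNReal.ofReal (36 * (1 + 2 * B) * B)
        * ∫⁻ x, maximalFunction m f x ^ (1 / 2 : ℝ) ∂(haar m) := by
  -- These sets increase with N and the bound for them does not depend on N, so continuity from
  -- below gives the full maximal operator. The shift N + 1 provides the required positive level.
  set E : ℕ → Set (VilenkinGroup m) := fun N => {x | ∃ n, 1 ≤ n ∧ n ≤ bigM m (N + 1) ∧
        n * (24 * B ^ 3 * s ^ 2) < ‖∑ k ∈ range n, partialSum m f k x‖} with hE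
  have hmono : Monotone E := fun i j hij x ⟨n, h1, h2, h3⟩ =>
    ⟨n, h1, h2.trans (bigM_mono (by omega)), h3⟩
  have hsub : {x | ENNReal.ofReal (48 * A * B ^ 3 * s ^ 2) < tMax m q f x} ⊆ ⋃ N, E N := by
    intro x hx
    obtain ⟨n, hn⟩ := lt_iSup_iff.1 (show _ < ⨆ n, ‖tMean m q f n x‖ₑ from hx)
    rw [← ofReal_norm,
      ENNReal.ofReal_lt_ofReal_iff_of_nonneg (by positivity)] at hn
    by_contra hcon
    simp only [Set.mem_iUnion, not_exists] at hcon
    refine absurd hn (not_lt.2 ((norm_tMean_le hq0 hq hA0 hA (D := 24 * B ^ 3 * s ^ 2)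
      (by positivity) fun j hj _ => ?_).trans (le_of_eq (by ring))))
    exact not_lt.1 fun h => hcon j ⟨j, hj, ((Nat.lt_succ_self j).trans (lt_bigM _)).le, h⟩
  refine (mul_le_mul_left (measure_mono hsub) _).trans ?_
  rw [hmono.measure_iUnion, ENNReal.iSup_mul]
  exact iSup_le fun N => measure_fejer_maximal_le hB hf (Nat.le_add_left 1 N) hs

theorem exists_weakNorm_tMax_le (hbdd : BddAbove (Set.range m)) {q : ℕ → ℝ} (hq0 : 0 < q 0)
    (hq : Monotone q)
    (hO : (fun n : ℕ => q (n - 1) / bigQ q n) =O[atTop] (fun n : ℕ => 1 / (n : ℝ))) :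
    ∃ C : ℝ≥0, ∀ f : ℕ → VilenkinGroup m → ℂ, MemHardy m (1 / 2) f →
        weakNorm m (1 / 2) (tMax m q f) ≤ C * hardyNorm m (1 / 2) f := by
  obtain ⟨B, hB⟩ := hbdd
  have hB' (k : ℕ) : m k ≤ B := hB ⟨k, rfl⟩
  have hB0 : (0 : ℝ) < B := by exact_mod_cast (Nat.pos_of_neZero (m 0)).trans_le (hB' 0)
  obtain ⟨A, hA0, hA⟩ := exists_ratio_bound hq0 hq hO
  set K : ℝ := 36 * (1 + 2 * B) * B with hK
  refine ⟨Real.toNNReal (48 * A * B ^ 3 * K ^ 2), fun f hf => ?_⟩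
  refine iSup₂_le fun t ht => ?_
  set a : ℝ := 48 * A * B ^ 3 with ha
  have ha0 : 0 < a := by positivity
  have ht' : (0 : ℝ) < t := ht
  -- Chosen so that t = a s^2; squaring the estimate linear in s then gives the weak-L_{1/2}
  -- quasi-norm.
  set s : ℝ := √(t / a) with hs
  have hs0 : 0 < s := Real.sqrt_pos.2 (by positivity)
  have hts : (t : ℝ) = a * s ^ 2 := by
    rw [hs, Real.sq_sqrt (by positivity)]
    field_simp
  have htE : (t : ℝ≥0∞) = ENNReal.ofReal (a * s ^ 2) := by
    rw [← hts, ENNReal.ofReal_coe_nnreal]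
  have key := weak_tMax_le hB' hq0 hq hA0 hA hf.1 hs0
  rw [← ha, ← htE, ← hK] at key
  unfold hardyNorm
  rw [show (1 : ℝ) / (1 / 2) = ((2 : ℕ) : ℝ) by norm_num, ENNReal.rpow_natCast,
    ENNReal.rpow_natCast]
  calc (t : ℝ≥0∞) * haar m {x | (t : ℝ≥0∞) < tMax m q f x} ^ 2
      = ENNReal.ofReal a
        * (haar m {x | (t : ℝ≥0∞) < tMax m q f x} * ENNReal.ofReal s) ^ 2 := by
        generalize haar m {x | (t : ℝ≥0∞) < tMax m q f x} = w
        rw [mul_pow, ← ENNReal.ofReal_pow hs0.le, htE, ENNReal.ofReal_mul ha0.le]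
        ring
    _ ≤ ENNReal.ofReal a * (ENNReal.ofReal K
          * ∫⁻ x, maximalFunction m f x ^ (1 / 2 : ℝ) ∂(haar m)) ^ 2 := by gcongr
    _ = _ := by
        have : ((48 * A * B ^ 3 * K ^ 2).toNNReal : ℝ≥0∞) = ENNReal.ofReal a * ENNReal.ofReal K ^ 2 := by
          rw [← ENNReal.ofReal_pow (by positivity), ← ENNReal.ofReal_mul ha0.le]
          rfl
        rw [this, mul_pow, mul_assoc]
/-! ### Sums of modulated atoms -/

/-- The function `a r_n 1_{I_n(0)}`. -/
def atomAt (a : ℝ) (n : ℕ) : VilenkinGroup m → ℂ :=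
  (interval m n 0).indicator fun x => a * rademacher m n x

/-- The martingale with the differences `a_n r_n 1_{I_n(0)}`. -/
def atomSum (a : ℕ → ℝ) (N : ℕ) (x : VilenkinGroup m) : ℂ := ∑ n ∈ range N, atomAt (a n) n x

theorem atLevel_atomAt (a : ℝ) (n : ℕ) : AtLevel (n + 1) (atomAt (m := m) a n) :=
  atLevel_indicator (Nat.le_succ n) 0
    ((atLevel_rademacher (Nat.lt_succ_self n)).comp fun w => (a : ℂ) * w)

theorem atLevel_atomSum (a : ℕ → ℝ) (N : ℕ) : AtLevel N (atomSum (m := m) a N) :=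
  AtLevel.sum fun n hn => (atLevel_atomAt (a n) n).mono (mem_range.1 hn)

theorem norm_atomAt {a : ℝ} (ha : 0 ≤ a) (n : ℕ) (x : VilenkinGroup m) :
    ‖atomAt a n x‖ = (interval m n 0).indicator (fun _ => a) x := by
  by_cases h : x ∈ interval m n 0
  · rw [atomAt, Set.indicator_of_mem h, Set.indicator_of_mem h, norm_mul, norm_rademacher,
      Complex.norm_real, Real.norm_of_nonneg ha, mul_one]
  · rw [atomAt, Set.indicator_of_notMem h, Set.indicator_of_notMem h, norm_zero]

theorem norm_atomSum_le {a : ℕ → ℝ} (ha : ∀ n, 0 ≤ a n) (N : ℕ) (x : VilenkinGroup m) :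
    ‖atomSum a N x‖ ≤ ∑ n ∈ range N, a n := by
  refine (norm_sum_le _ _).trans (sum_le_sum fun n _ => ?_)
  rw [norm_atomAt (ha n)]
  exact Set.indicator_le_self' (f := fun _ => a n) (fun _ _ => ha n) x

theorem integral_atomAt_mul_eq_zero (a : ℝ) {n : ℕ} {h : VilenkinGroup m → ℂ} (hh : AtLevel n h) :
    ∫ x, atomAt a n x * h x ∂(haar m) = 0 := by
  have h1 := integral_mul_eq_zero (n := n)
    (((atLevel_rademacher (m := m) (Nat.lt_succ_self n)).comp (· ^ 1)).integrable)
    (fun z => setIntegral_rademacher_pow one_pos (hm.out n) z)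
    (atLevel_indicator le_rfl 0 (hh.comp fun w => (a : ℂ) * w))
  rw [← h1]
  refine integral_congr_ae (ae_of_all _ fun x => ?_)
  by_cases hx : x ∈ interval m n 0
  · simp only [atomAt, Set.indicator_of_mem hx]
    ring
  · simp only [atomAt, Set.indicator_of_notMem hx]
    ring

theorem martingale_atomSum (a : ℕ → ℝ) :
    Martingale (atomSum (m := m) a) (filtration m) (haar m) := by
  classical
  refine martingale_of_setIntegral_eq_succ
    (fun n => (atLevel_atomSum a n).measurable_filtration.stronglyMeasurable)
    (fun n => (atLevel_atomSum a n).integrable) fun n s hs => ?_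
  have hs' := (filtration m).le n s hs
  have h1 (x : VilenkinGroup m) : atomSum a (n + 1) x = atomSum a n x + atomAt (a n) n x :=
    sum_range_succ _ _
  simp_rw [h1]
  rw [integral_add (atLevel_atomSum a n).integrable.integrableOn
    (atLevel_atomAt (a n) n).integrable.integrableOn, left_eq_add, ← integral_indicator hs',
    ← integral_atomAt_mul_eq_zero (m := m) (a n) (n := n) (h := s.indicator 1)]
  · refine integral_congr_ae (ae_of_all _ fun x => ?_)
    by_cases hx : x ∈ s <;> simp [hx]
  · exact (atLevel_of_measurableSet hs).comp fun P => {_u : Unit | P}.indicator (fun _ => (1 : ℂ)) ()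

theorem rpow_sum_le_sum_rpow {ι : Type*} {p : ℝ} (hp : 0 < p) (hp1 : p ≤ 1) (s : Finset ι)
    (u : ι → ℝ≥0∞) : (∑ i ∈ s, u i) ^ p ≤ ∑ i ∈ s, u i ^ p := by
  classical
  induction s using Finset.induction_on with
  | empty => simp [hp]
  | insert i s hi ih =>
    rw [sum_insert hi, sum_insert hi]
    exact (ENNReal.rpow_add_le_add_rpow _ _ hp.le hp1).trans (by gcongr)

theorem maximalFunction_atomSum_rpow_le {p : ℝ} (hp : 0 < p) (hp1 : p ≤ 1) {a : ℕ → ℝ}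
    (ha : ∀ n, 0 ≤ a n) (x : VilenkinGroup m) :
    maximalFunction m (atomSum a) x ^ p
      ≤ ∑' n, (interval m n 0).indicator (fun _ => ENNReal.ofReal (a n) ^ p) x := by
  rw [← ENNReal.le_rpow_inv_iff hp]
  refine iSup_le fun N => ?_
  rw [ENNReal.le_rpow_inv_iff hp]
  have h1 (n : ℕ) : ‖atomAt (a n) n x‖ₑ ^ p
      = (interval m n 0).indicator (fun _ => ENNReal.ofReal (a n) ^ p) x := by
    rw [← ofReal_norm, norm_atomAt (ha n)]
    by_cases h : x ∈ interval m n 0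
    · rw [Set.indicator_of_mem h, Set.indicator_of_mem h]
    · rw [Set.indicator_of_notMem h, Set.indicator_of_notMem h, ENNReal.ofReal_zero,
        ENNReal.zero_rpow_of_pos hp]
  calc ‖atomSum a N x‖ₑ ^ p ≤ (∑ n ∈ range N, ‖atomAt (a n) n x‖ₑ) ^ p := by
        gcongr; exact enorm_sum_le _ _
    _ ≤ ∑ n ∈ range N, ‖atomAt (a n) n x‖ₑ ^ p := rpow_sum_le_sum_rpow hp hp1 _ _
    _ = ∑ n ∈ range N, (interval m n 0).indicator (fun _ => ENNReal.ofReal (a n) ^ p) x :=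
        sum_congr rfl fun n _ => h1 n
    _ ≤ _ := ENNReal.sum_le_tsum _

/-- The factor M_n^{1/p} normalizes the atoms: its p-th power times μ(I_n) is 1. By p-subadditivity
the integral of (f^*)^p is at most ∑ w_n^p. -/
theorem memHardy_atomSum {p : ℝ} (hp : 0 < p) (hp1 : p ≤ 1) {w : ℕ → ℝ} (hw : ∀ n, 0 ≤ w n)
    (hsum : ∑' n, ENNReal.ofReal (w n) ^ p ≠ ∞) :
    MemHardy m p (atomSum fun n => w n * (bigM m n : ℝ) ^ (1 / p)) := by
  refine ⟨martingale_atomSum _, ENNReal.rpow_lt_top_of_nonneg (by positivity) (ne_of_lt ?_)⟩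
  have ha (n : ℕ) : 0 ≤ w n * (bigM m n : ℝ) ^ (1 / p) := mul_nonneg (hw n) (by positivity)
  refine (lintegral_mono fun x => maximalFunction_atomSum_rpow_le hp hp1 ha x).trans_lt ?_
  rw [lintegral_tsum fun n => (measurable_const.indicator (measurableSet_interval m n 0)).aemeasurable]
  refine lt_of_le_of_lt (le_of_eq (tsum_congr fun n => ?_)) (lt_top_iff_ne_top.2 hsum)
  have hM := bigM_cast_pos (m := m) n
  rw [lintegral_indicator_const (measurableSet_interval m n 0),
    ENNReal.ofReal_mul (hw n), ENNReal.mul_rpow_of_nonneg _ _ hp.le,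
    ENNReal.ofReal_rpow_of_nonneg (Real.rpow_nonneg hM.le _) hp.le, ← Real.rpow_mul hM.le,
    one_div_mul_cancel hp.ne', Real.rpow_one, ← ofReal_measureReal, haar_interval, mul_assoc,
    ← ENNReal.ofReal_mul hM.le, mul_inv_cancel₀ hM.ne', ENNReal.ofReal_one, mul_one]

/-! ### Divergence of the `T` means -/

theorem integral_mul_dirichlet {N k : ℕ} (hk : k ≤ bigM m N) {g : VilenkinGroup m → ℂ}
    (hg : AtLevel N g) (x : VilenkinGroup m) :
    ∫ y, g y * dirichlet k x y ∂(haar m)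
      = ∑ i ∈ range k, psi m i x * ∫ y, g y * conj (psi m i y) ∂(haar m) := by
  unfold dirichlet
  simp_rw [mul_sum]
  rw [integral_finsetSum]
  · refine sum_congr rfl fun i _ => ?_
    rw [← integral_const_mul]
    exact integral_congr_ae (ae_of_all _ fun y => by ring)
  · intro i hi
    exact (hg.comp₂ (atLevel_psi ((mem_range.1 hi).trans_le hk))
      fun u v => u * (psi m i x * conj v)).integrable

/-- The partial sums of a function of level `β` are bounded independently of their order. -/
theorem norm_integral_mul_dirichlet_le {β N k : ℕ} (hβ : β ≤ N) (hk : k ≤ bigM m N)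
    {g : VilenkinGroup m → ℂ} (hg : AtLevel β g) {D : ℝ} (hD : ∀ y, ‖g y‖ ≤ D)
    (x : VilenkinGroup m) : ‖∫ y, g y * dirichlet k x y ∂(haar m)‖ ≤ bigM m β * D := by
  have hD0 : 0 ≤ D := (norm_nonneg _).trans (hD x)
  rw [integral_mul_dirichlet hk (hg.mono hβ)]
  have hterm (i : ℕ) : ‖psi m i x * ∫ y, g y * conj (psi m i y) ∂(haar m)‖
      ≤ if i ∈ range (bigM m β) then D else 0 := by
    rw [norm_mul, norm_psi, one_mul]
    split_ifs with hi
    · refine (norm_integral_le_of_norm_le_const (C := D) (ae_of_all _ fun y => ?_)).trans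
        (by simp)
      rw [norm_mul, RCLike.norm_conj, norm_psi, mul_one]
      exact hD y
    -- A function of level β has no Fourier coefficients of order M_β or more, so at most M_β terms
    -- remain whatever k is.
    · rw [integral_mul_conj_psi_eq_zero (by simpa using hi) hg, norm_zero]
  refine (norm_sum_le _ _).trans ((sum_le_sum fun i _ => hterm i).trans ?_)
  rw [sum_ite_mem, sum_const, nsmul_eq_mul]
  gcongr
  exact (card_le_card inter_subset_right).trans (card_range _).le

theorem psi_bigM (A : ℕ) (x : VilenkinGroup m) : psi m (bigM m A) x = rademacher m A x := by
  have h := psi_add (m := m) (A := A) (s := 1) (l := 0) (hm.out A) (bigM_pos A) x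
  rw [one_mul, add_zero, pow_one] at h
  rw [h]
  simp [psi]

theorem integral_atomAt_mul_dirichlet (a : ℝ) {A k : ℕ} (hk : k ≤ bigM m A)
    (x : VilenkinGroup m) : ∫ y, atomAt a A y * dirichlet k x y ∂(haar m) = 0 :=
  integral_atomAt_mul_eq_zero a (atLevel_dirichlet hk x)

/-- Only ψ_{M_A} = r_A contributes, with coefficient a μ(I_A(0)) = a / M_A. A character has modulus
1 everywhere, so a function concentrated on I_A(0) acquires a partial sum of constant modulus on the
whole group. -/
theorem norm_integral_atomAt_mul_dirichlet_succ {a : ℝ} (ha : 0 ≤ a) (A : ℕ)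
    (x : VilenkinGroup m) :
    ‖∫ y, atomAt a A y * dirichlet (bigM m A + 1) x y ∂(haar m)‖ = a / bigM m A := by
  have hle : bigM m A + 1 ≤ bigM m (A + 1) := by
    have := two_mul_bigM_le (m := m) A
    have := bigM_pos (m := m) A
    omega
  rw [integral_mul_dirichlet hle (atLevel_atomAt a A), sum_range_succ,
    ← integral_mul_dirichlet ((Nat.le_succ _).trans hle) (atLevel_atomAt a A),
    integral_atomAt_mul_dirichlet a le_rfl, zero_add, norm_mul, norm_psi, one_mul]
  have h1 (y : VilenkinGroup m) : atomAt a A y * conj (psi m (bigM m A) y)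
      = (interval m A 0).indicator (fun _ => (a : ℂ)) y := by
    by_cases h : y ∈ interval m A 0
    · rw [atomAt, Set.indicator_of_mem h, Set.indicator_of_mem h, psi_bigM, mul_assoc,
        rademacher_mul_conj_self, mul_one]
    · rw [atomAt, Set.indicator_of_notMem h, Set.indicator_of_notMem h, zero_mul]
  simp_rw [h1]
  rw [integral_indicator_const _ (measurableSet_interval m A 0), haar_interval, norm_smul,
    Complex.norm_real, Real.norm_of_nonneg ha, Real.norm_of_nonneg (by positivity),
    inv_mul_eq_div]

theorem bigQ_le {q : ℕ → ℝ} (hq : Monotone q) (n : ℕ) : bigQ q (n + 1) ≤ (n + 1) * q n := by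
  refine (sum_le_card_nsmul _ _ (q n) fun k hk => hq (by simpa [Nat.lt_succ_iff] using hk)).trans ?_
  simp

/-- Lower bound for the `T` mean of order `M_α + 2` of a lacunary sum of atoms. -/
theorem le_norm_tMean_atomSum {q : ℕ → ℝ} (hq0 : 0 < q 0) (hq : Monotone q) {a : ℕ → ℝ}
    (ha : ∀ n, 0 ≤ a n) {α β : ℕ} (hβα : β ≤ α) (hgap : ∀ n, β ≤ n → n < α → a n = 0)
    (x : VilenkinGroup m) :
    a α / (3 * (bigM m α : ℝ) ^ 2) - bigM m β * ∑ n ∈ range β, a n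
      ≤ ‖tMean m q (atomSum a) (bigM m α + 2) x‖ := by
  have hM := bigM_cast_pos (m := m) α
  -- T_{n+1} is the first mean containing S_{M_α+1}, that is, the first one in which ψ_{M_α} occurs.
  set n := bigM m α + 1 with hn
  have hle : n ≤ bigM m (α + 1) := by
    have := two_mul_bigM_le (m := m) α
    have := bigM_pos (m := m) α
    omega
  set D : ℝ := bigM m β * ∑ n ∈ range β, a n with hD
  have hlevel (y : VilenkinGroup m) : atomSum a (α + 1) y = atomSum a β y + atomAt (a α) α y := by
    rw [atomSum, sum_range_succ, atomSum]
    congr 1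
    refine (sum_subset (range_subset_range.2 hβα) fun k hk hk' => ?_).symm
    rw [atomAt, hgap k (by simpa using hk') (mem_range.1 hk)]
    simp
  set u : ℕ → ℂ := fun k => ∫ y, atomSum a β y * dirichlet k x y ∂(haar m) with hu
  have hpart (k : ℕ) (hk : k ≤ n) : partialSum m (atomSum a) k x
      = u k + ∫ y, atomAt (a α) α y * dirichlet k x y ∂(haar m) := by
    have hk' := hk.trans hle
    rw [partialSum_eq (martingale_atomSum a) hk', hu, ← integral_add
      ((((atLevel_atomSum a β).mono (hβα.trans (Nat.le_succ α))).comp₂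
        (atLevel_dirichlet hk' x) (· * ·)).integrable)
      (((atLevel_atomAt (a α) α).comp₂ (atLevel_dirichlet hk' x) (· * ·)).integrable)]
    refine integral_congr_ae (ae_of_all _ fun y => ?_)
    simp only [hlevel, add_mul]
  have hunorm (k : ℕ) (hk : k ≤ n) : ‖u k‖ ≤ D :=
    norm_integral_mul_dirichlet_le (hβα.trans (Nat.le_succ α)) (hk.trans hle)
      (atLevel_atomSum a β) (norm_atomSum_le ha β) x
  have hQ := bigQ_pos hq0 hq (Nat.le_add_left 1 n)
  set v : ℂ := ∫ y, atomAt (a α) α y * dirichlet n x y ∂(haar m) with hv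
  have hvnorm : ‖v‖ = a α / bigM m α := norm_integral_atomAt_mul_dirichlet_succ (ha α) α x
  have hsum : ∑ k ∈ range (n + 1), (q k : ℂ) * partialSum m (atomSum a) k x
      = ∑ k ∈ range (n + 1), (q k : ℂ) * u k + q n * v := by
    rw [sum_range_succ, sum_range_succ (fun k => (q k : ℂ) * u k), hpart n le_rfl]
    have : ∑ k ∈ range n, (q k : ℂ) * partialSum m (atomSum a) k x
        = ∑ k ∈ range n, (q k : ℂ) * u k := by
      refine sum_congr rfl fun k hk => ?_
      have hk' := mem_range.1 hk
      rw [hpart k hk'.le, integral_atomAt_mul_dirichlet _ (by omega), add_zero]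
    rw [this]
    ring
  have hqn : 0 < q n := hq0.trans_le (hq (Nat.zero_le n))
  have h1 : ‖∑ k ∈ range (n + 1), (q k : ℂ) * u k‖ ≤ bigQ q (n + 1) * D := by
    rw [bigQ, sum_mul]
    refine (norm_sum_le _ _).trans (sum_le_sum fun k hk => ?_)
    rw [norm_mul, Complex.norm_real, Real.norm_of_nonneg (hq0.le.trans (hq (Nat.zero_le k)))]
    gcongr
    · exact hq0.le.trans (hq (Nat.zero_le k))
    · exact hunorm k (Nat.lt_succ_iff.1 (mem_range.1 hk))
  -- Monotonicity of q gives Q_{n+1} ≤ (n + 1) q_n, and n + 1 = M_α + 2 ≤ 3 M_α.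
  have h2 : bigQ q (n + 1) ≤ 3 * bigM m α * q n := by
    refine (bigQ_le hq n).trans ?_
    have : (n : ℝ) + 1 ≤ 3 * bigM m α := by
      have := one_le_bigM (m := m) α
      rw [hn]
      push_cast
      linarith
    gcongr
  have h3 : bigQ q (n + 1) * (a α / (3 * (bigM m α : ℝ) ^ 2)) ≤ ‖(q n : ℂ) * v‖ := by
    rw [norm_mul, hvnorm, Complex.norm_real, Real.norm_of_nonneg hqn.le]
    calc _ ≤ 3 * bigM m α * q n * (a α / (3 * (bigM m α : ℝ) ^ 2)) := by
          have := ha α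
          gcongr
      _ = _ := by field_simp
  have h4 := norm_sub_le (∑ k ∈ range (n + 1), (q k : ℂ) * u k + q n * v)
    (∑ k ∈ range (n + 1), (q k : ℂ) * u k)
  rw [add_sub_cancel_left] at h4
  rw [tMean, show bigM m α + 2 = n + 1 from rfl, hsum, norm_mul, norm_div, norm_one,
    Complex.norm_real, Real.norm_of_nonneg hQ.le, one_div_mul_eq_div, le_div_iff₀ hQ]
  linarith

theorem le_weakNorm {p : ℝ} {F : VilenkinGroup m → ℝ≥0∞} {t : ℝ≥0} (ht : 0 < t)
    (h : ∀ x, (t : ℝ≥0∞) < F x) : (t : ℝ≥0∞) ≤ weakNorm m p F := by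
  refine le_iSup₂_of_le t ht ?_
  have : {x | (t : ℝ≥0∞) < F x} = Set.univ := Set.eq_univ_of_forall h
  rw [this, measure_univ, ENNReal.one_rpow, mul_one]

/-- A sparse sequence along which the atoms dominate all preceding ones. -/
theorem exists_sparse_sequence {p : ℝ} (hp : 0 < p) (hp2 : p < 1 / 2) (Φ : ℕ → ℝ) :
    ∃ α : ℕ → ℕ, StrictMono α ∧ ∀ k, k + Φ (α k + 1)
      < (1 / 2 : ℝ) ^ (((k + 1 : ℕ) : ℝ) / p) * (bigM m (α (k + 1)) : ℝ) ^ (1 / p)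
        / (3 * (bigM m (α (k + 1)) : ℝ) ^ 2) := by
  have hex (k β : ℕ) : ∃ n, β < n ∧ k + Φ (β + 1)
      < (1 / 2 : ℝ) ^ (((k + 1 : ℕ) : ℝ) / p) * (bigM m n : ℝ) ^ (1 / p)
        / (3 * (bigM m n : ℝ) ^ 2) := by
    -- This is where p < 1/2 enters: M_n^{1/p} outgrows M_n^2.
    have hexp : 0 < 1 / p - 2 := by
      rw [sub_pos, lt_div_iff₀ hp]
      linarith
    have h1 : Tendsto (fun n => (bigM m n : ℝ)) atTop atTop :=
      tendsto_atTop_mono (fun n => by exact_mod_cast (lt_bigM n).le) tendsto_natCast_atTop_atTop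
    have h2 := ((tendsto_rpow_atTop hexp).comp h1).const_mul_atTop
      (show (0 : ℝ) < (1 / 2 : ℝ) ^ (((k + 1 : ℕ) : ℝ) / p) / 3 by positivity)
    obtain ⟨n, hn, hn'⟩ := ((h2.eventually_gt_atTop (k + Φ (β + 1))).and
      (eventually_gt_atTop β)).exists
    refine ⟨n, hn', hn.trans_le (le_of_eq ?_)⟩
    have hM := bigM_cast_pos (m := m) n
    rw [Function.comp_apply, Real.rpow_sub hM, Real.rpow_two]
    field_simp
  choose g hg1 hg2 using hex
  obtain ⟨α, hα⟩ : ∃ α : ℕ → ℕ, ∀ k, α (k + 1) = g k (α k) :=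
    ⟨fun k => Nat.rec 0 g k, fun _ => rfl⟩
  refine ⟨α, strictMono_nat_of_lt_succ fun k => ?_, fun k => ?_⟩
  · rw [hα]
    exact hg1 k _
  · rw [hα]
    exact hg2 k _

theorem exists_weakNorm_tMean_eq_top {p : ℝ} (hp : 0 < p) (hp2 : p < 1 / 2) {q : ℕ → ℝ}
    (hq0 : 0 < q 0) (hq : Monotone q) :
    ∃ f : ℕ → VilenkinGroup m → ℂ, MemHardy m p f ∧
      ⨆ n : ℕ, weakNorm m p (fun x => ‖tMean m q f n x‖ₑ) = ∞ := by
  -- The sequence must be chosen before w is defined on it, so the bound for the earlier atoms is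
  -- taken with all w_n replaced by 1; this suffices because 0 ≤ w_n ≤ 1.
  obtain ⟨α, hα, hbig⟩ := exists_sparse_sequence (m := m) hp hp2
    fun β => bigM m β * ∑ n ∈ range β, (bigM m n : ℝ) ^ (1 / p)
  set w : ℕ → ℝ := Function.extend α (fun k => (1 / 2 : ℝ) ^ ((k : ℝ) / p)) 0 with hw
  have hwα (k : ℕ) : w (α k) = (1 / 2 : ℝ) ^ ((k : ℝ) / p) := hα.injective.extend_apply _ _ k
  have hwn {n : ℕ} (hn : ¬ ∃ k, α k = n) : w n = 0 := Function.extend_apply' _ _ n hn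
  have hw01 (n : ℕ) : 0 ≤ w n ∧ w n ≤ 1 := by
    by_cases hn : ∃ k, α k = n
    · obtain ⟨k, rfl⟩ := hn
      rw [hwα]
      exact ⟨by positivity, Real.rpow_le_one (by norm_num) (by norm_num) (by positivity)⟩
    · rw [hwn hn]
      exact ⟨le_rfl, zero_le_one⟩
  set a : ℕ → ℝ := fun n => w n * (bigM m n : ℝ) ^ (1 / p) with ha
  have ha0 (n : ℕ) : 0 ≤ a n := mul_nonneg (hw01 n).1 (by positivity)
  refine ⟨atomSum a, memHardy_atomSum hp (by linarith) (fun n => (hw01 n).1) ?_, ?_⟩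
  · have h1 (n : ℕ) : ENNReal.ofReal (w n) ^ p
        = Function.extend α (fun k => (2⁻¹ : ℝ≥0∞) ^ k) 0 n := by
      by_cases hn : ∃ k, α k = n
      · obtain ⟨k, rfl⟩ := hn
        rw [hwα, hα.injective.extend_apply, ENNReal.ofReal_rpow_of_nonneg (by positivity) hp.le,
          ← Real.rpow_mul (by norm_num), div_mul_cancel₀ _ hp.ne', Real.rpow_natCast,
          ENNReal.ofReal_pow (by norm_num), one_div, ENNReal.ofReal_inv_of_pos two_pos,
          ENNReal.ofReal_ofNat]
      · rw [hwn hn, Function.extend_apply' _ _ n hn, ENNReal.ofReal_zero,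
          ENNReal.zero_rpow_of_pos hp, Pi.zero_apply]
    simp_rw [h1]
    rw [tsum_extend_zero hα.injective, ENNReal.tsum_geometric_two]
    exact ENNReal.ofNat_ne_top
  · refine ENNReal.eq_top_of_forall_nnreal_le fun t => ?_
    obtain ⟨k, hk⟩ := exists_nat_gt t
    have hk0 : (0 : ℝ≥0) < k := lt_of_le_of_lt t.2 hk
    refine le_trans ?_ (le_iSup _ (bigM m (α (k + 1)) + 2))
    refine le_trans (by exact_mod_cast hk.le) (le_weakNorm hk0 fun x => ?_)
    -- With β = α k + 1 the atom at α k belongs to the earlier part, and there is none strictly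
    -- between α k and α (k + 1).
    have hlow := le_norm_tMean_atomSum hq0 hq ha0 (α := α (k + 1)) (β := α k + 1)
      (hα (Nat.lt_succ_self k)) (fun n hn hn' => ?_) x
    · have h2 := hbig k
      have h3 : bigM m (α k + 1) * ∑ n ∈ range (α k + 1), a n
          ≤ bigM m (α k + 1) * ∑ n ∈ range (α k + 1), (bigM m n : ℝ) ^ (1 / p) := by
        gcongr with n
        exact mul_le_of_le_one_left (by positivity) (hw01 n).2
      have h4 : (k : ℝ) < ‖tMean m q (atomSum a) (bigM m (α (k + 1)) + 2) x‖ := by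
        simp only [ha, hwα] at hlow h3 ⊢
        linarith
      rw [← ofReal_norm]
      have h5 : ((k : ℝ≥0) : ℝ≥0∞) = ENNReal.ofReal k := by simp
      rw [h5]
      exact (ENNReal.ofReal_lt_ofReal_iff_of_nonneg (Nat.cast_nonneg k)).2 h4
    · simp only [ha]
      rw [hwn, zero_mul]
      rintro ⟨j, rfl⟩
      have h1 := hα.lt_iff_lt.1 (Nat.lt_of_succ_le hn)
      have h2 := hα.lt_iff_lt.1 hn'
      omega

end

end Vilenkin

theorem mainTheorem4 (m : ℕ → ℕ) (hm : ∀ k, 2 ≤ m k) (hbdd : BddAbove (Set.range m)) :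
    (∀ q : ℕ → ℝ, 0 < q 0 → Monotone q →
      (fun n : ℕ => q (n - 1) / Vilenkin.bigQ q n) =O[atTop] (fun n : ℕ => 1 / (n : ℝ)) →
      ∃ C : ℝ≥0, ∀ f : ℕ → VilenkinGroup m → ℂ, Vilenkin.MemHardy m (1 / 2) f →
        Vilenkin.weakNorm m (1 / 2) (Vilenkin.tMax m q f)
          ≤ C * Vilenkin.hardyNorm m (1 / 2) f) ∧
    (∀ p : ℝ, 0 < p → p < 1 / 2 → ∀ q : ℕ → ℝ, 0 < q 0 → Monotone q →
      ∃ f : ℕ → VilenkinGroup m → ℂ, Vilenkin.MemHardy m p f ∧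
        ⨆ n : ℕ, Vilenkin.weakNorm m p (fun x => ‖Vilenkin.tMean m q f n x‖ₑ) = ∞) := by
  have : Fact (∀ k, 2 ≤ m k) := ⟨hm⟩
  exact ⟨fun q hq0 hq hO => Vilenkin.exists_weakNorm_tMax_le hbdd hq0 hq hO,
    fun p hp hp2 q hq0 hq => Vilenkin.exists_weakNorm_tMean_eq_top hp hp2 hq0 hq⟩
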